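/- Let $X$ be a set with at least two elements. Maps are composed from left to right, $(x)ab=((x)a)b$. **Objects.** $Sing(X)$ is the semigroup of singular maps $X\to X$, i.e. those that are neither injective nor surjective (for finite $X$: the non-invertible maps). For $a\in Sing(X)$ let $\operatorname{Im} a$ be its image and $\pi_a$ the partition of $X$ into the fibres of $a$. $\mathscr P(X)$ is the category of non-empty proper subsets of $X$, with all functions as morphisms and the set inclusions as inclusions. $\Pi(X)$ is the category whose objects $\bar\pi$ correspond to the non-identity partitions $\pi$ of $X$ ($\bar\pi$ is the set of all functions $\pi\to X$) and whose morphisms $\bar\pi_1\to\bar\pi_2$ are the maps $\eta^*:\alpha\mapsto\eta\alpha$ with $\eta:\pi_2\to\pi_1$ a function; its inclusions are the $\nu^*:\bar\pi_1\to\bar\pi_2$, where each block of $\pi_2$ is contained in a block of $\pi_1$ and $\nu$ takes it to that block. Both are normal categories in the sense of Nambooripad, and so is each ideal of them (a full subcategory closed under subobjects). **Cones, duals, cross-connections.** For a normal category $\mathcal C$, let $T\mathcal C$ be the set of normal cones $\gamma$ in $\mathcal C$ (with vertex $c_\gamma$), with product $\gamma\cdot\sigma=\gamma*(\sigma(c_\gamma))^\circ$,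 where $f^\circ$ is the epimorphic component of $f$ and $(\gamma * g)(c)=\gamma(c)g$. The H-functor of $\gamma$ is $H(\gamma;c)=\{\gamma*f^\circ: f\in\mathcal C(c_\gamma,c)\}$, $H(\gamma;g):\gamma*f^\circ\mapsto\gamma*(fg)^\circ$; the normal dual $N^*\mathcal C$ has the functors $H(\varepsilon;-)$, $\varepsilon$ an idempotent of $T\mathcal C$, as objects and the natural transformations as morphisms, with subfunctors as subobjects; $MH(\varepsilon;-)=\{c:\varepsilon(c)\text{ is an isomorphism}\}$. A cross-connection $(\mathcal D,\mathcal C;\Gamma)$ is a functor $\Gamma:\mathcal D\to N^*\mathcal C$ that is a local isomorphism (inclusion preserving, fully faithful, and an isomorphism of each principal ideal $\langle d\rangle$ onto $\langle\Gamma(d)\rangle$) such that each $c\in v\mathcal C$ lies in $M\Gamma(d)$ for some $d$. A cross-connection $(\mathcal C,\mathcal D;\Delta)$ is dual to it, with duality $\chi$, if $c\in M\Gamma(d)\iff d\in M\Delta(c)$, and $\chi$ is a natural isomorphism from $\Gamma(-,-)$ to $\Delta(-,-)$, where $\Gamma(c,d)=\Gamma(d)(c)$ and $\Delta(c,d)=\Delta(c)(d)$,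 such that whenever $c\in M\Gamma(d)$, $\chi(c,d)$ takes the idempotent cone $\gamma$ with vertex $c$ and $\Gamma(d)=H(\gamma;-)$ to the idempotent cone $\delta$ with vertex $d$ and $\Delta(c)=H(\delta;-)$. The cross-connection semigroup $\tilde S\Gamma$ consists of the linked pairs, i.e. the pairs $(\gamma,\chi(c,d)(\gamma))$ with $\gamma\in\Gamma(c,d)$ for some $(c,d)$, under $(\gamma,\delta)\circ(\gamma',\delta')=(\gamma\cdot\gamma',\delta'\cdot\delta)$. **Cones of transformations.** For $a\in Sing(X)$, $\rho^a$ is the normal cone in $\mathscr P(X)$ with vertex $\operatorname{Im}a$ and components $a|_A$. $\Pi(X)$ is identified with $N^*\mathscr P(X)$ by $\bar\pi\mapsto H(\rho^e;-)$, $e$ an idempotent with $\pi_e=\pi$, and $\eta^*\mapsto(\rho^e * g^\circ\mapsto\rho^{f} * (wg)^\circ)$ for $\eta:\pi_f\to\pi_e$, where $w:\operatorname{Im}f\to\operatorname{Im}e$ is the map induced by $\eta$. An ideal $\mathcal I$ of $\Pi(X)$ is total if each $A\in v\mathscr P(X)$ belongs to the M-set of the H-functor of some $\bar\pi\in v\mathcal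 I$. For an ideal $\mathcal I$ and $\bar\pi_a\in v\mathcal I$, $\sigma^a$ is the cone in $\mathcal I$ with vertex $\bar\pi_a$ whose component at $\bar\pi$ is $\eta^*$ with $\eta:\pi_a\to\pi$, $[x]\mapsto[xa]$. **Theorem.** Let $\mathcal I$ be a total ideal of $\Pi(X)$ and let $\Gamma=j(\mathcal I,\Pi(X))$ be the inclusion functor, regarded as a functor $\mathcal I\to N^*\mathscr P(X)$ by the above identification. Then: 1. $(\mathcal I,\mathscr P(X);\Gamma)$ is a cross-connection. 2. It has a unique dual cross-connection $\Delta:\mathscr P(X)\to N^*\mathcal I$. This is the identity of $\mathscr P(X)$, when $H(\sigma^e;-)$ is identified with $\operatorname{Im}e$: $\Delta(\operatorname{Im} e)=H(\sigma^e;-)$ for every idempotent $e\in Sing(X)$ with $\bar\pi_e\in v\mathcal I$, and for $f:\operatorname{Im}e\to\operatorname{Im}e'$ ($e,e'$ such idempotents) $\Delta(f)$ is the natural transformation $\sigma^e*g^\circ\mapsto\sigma^{e'}*(\hat f g)^\circ$, where $\hat f:\bar\pi_{e'}\to\bar\pi_e$ is given by the map $\pi_e\to\pi_{e'}$, $[x]\mapsto[(xe)f]$.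 3. $S=\{a\in Sing(X):\bar\pi_a\in v\mathcal I\}$ is a subsemigroup of $Sing(X)$ that is regular and right reductive (if $xa=xb$ for all $x\in S$ then $a=b$), the linked pairs are closed under $\circ$, and $a\mapsto(\rho^a,\sigma^a)$ is an isomorphism of $S$ onto $\tilde S\Gamma$. -/

import Mathlib

open CategoryTheory

universe u

namespace CrossConnection

/-! ## Normal categories

All functions and morphisms are composed from left to right, as `≫` does. -/

/-- A (small) category with subobjects: a category `C` with a partial order `Sub` on its objects
and, for `Sub c d`, a distinguished morphism `incl : c ⟶ d` (the inclusion `j(c, d)`).  The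
inclusions form a subcategory, they are monomorphisms, and if `f ≫ j = j'` with `j, j'`
inclusions then `f` is an inclusion. -/
class SubobjectCategory (C : Type u) extends Category.{u} C where
  Sub : C → C → Prop
  sub_refl : ∀ c, Sub c c
  sub_trans : ∀ {a b c}, Sub a b → Sub b c → Sub a c
  sub_antisymm : ∀ {a b}, Sub a b → Sub b a → a = b
  incl : ∀ {c d : C}, Sub c d → (c ⟶ d)
  incl_refl : ∀ c, incl (sub_refl c) = 𝟙 c
  incl_comp : ∀ {a b c : C} (h : Sub a b) (h' : Sub b c),
    incl h ≫ incl h' = incl (sub_trans h h')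
  incl_mono : ∀ {c d : C} (h : Sub c d), Mono (incl h)
  incl_factor : ∀ {a b c : C} (h : Sub a c) (h' : Sub b c) (f : a ⟶ b),
    f ≫ incl h' = incl h → ∃ k : Sub a b, f = incl k

open SubobjectCategory

attribute [instance] SubobjectCategory.incl_mono

section Normal

variable {C : Type u} [SubobjectCategory C]

/-- A normal factorization `f = e u j`: a retraction, an isomorphism, and an inclusion. -/
structure NormalFactorization {c d : C} (f : c ⟶ d) where
  coimg : C
  img : C
  sub_coimg : Sub coimg c
  sub_img : Sub img d
  e : c ⟶ coimg
  u : coimg ≅ img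
  retraction : incl sub_coimg ≫ e = 𝟙 coimg
  fac : e ≫ u.hom ≫ incl sub_img = f

/-- The epimorphic component `f° = e u` given by a normal factorization of `f`. -/
def NormalFactorization.epi {c d : C} {f : c ⟶ d} (F : NormalFactorization f) : c ⟶ F.img :=
  F.e ≫ F.u.hom

variable (C) in
/-- A cone in `C`, with base the set of all objects of `C`. -/
structure SubCone where
  vertex : C
  app : ∀ c : C, c ⟶ vertex
  compat : ∀ {c c' : C} (h : Sub c c'), incl h ≫ app c' = app c

variable (C) in
/-- A normal cone: a cone of which at least one component is an isomorphism. -/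
structure NormalCone extends SubCone C where
  normal : ∃ c, IsIso (app c)

/-- The M-set of a normal cone. -/
def NormalCone.mSet (γ : NormalCone C) : Set C := {c | IsIso (γ.app c)}

variable (C) in
/-- Normal categories. -/
class IsNormalCategory : Prop where
  factorization : ∀ {c d : C} (f : c ⟶ d), Nonempty (NormalFactorization f)
  splits : ∀ {c d : C} (h : Sub c d), ∃ e : d ⟶ c, incl h ≫ e = 𝟙 c
  exists_cone : ∀ c : C, ∃ γ : NormalCone C, γ.vertex = c ∧ γ.app γ.vertex = 𝟙 _

theorem NormalCone.ext' {γ δ : NormalCone C} (h : γ.vertex = δ.vertex)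
    (happ : ∀ c, γ.app c ≫ eqToHom h = δ.app c) : γ = δ := by
  obtain ⟨⟨v, a, _⟩, _⟩ := γ
  obtain ⟨⟨w, b, _⟩, _⟩ := δ
  dsimp at h
  subst h
  have : a = b := by
    funext c
    simpa using happ c
  subst this
  rfl

section Fac

variable {c d : C} {f : c ⟶ d}

/-- The right inverse of the epimorphic component. -/
def NormalFactorization.sec (F : NormalFactorization f) : F.img ⟶ c :=
  F.u.inv ≫ incl F.sub_coimg

theorem NormalFactorization.sec_epi (F : NormalFactorization f) : F.sec ≫ F.epi = 𝟙 _ := by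
  have := F.retraction
  simp only [sec, epi, Category.assoc]
  rw [reassoc_of% this]
  simp

theorem NormalFactorization.epi_incl (F : NormalFactorization f) :
    F.epi ≫ incl F.sub_img = f := by
  simpa [epi] using F.fac

theorem NormalFactorization.sec_fac (F : NormalFactorization f) :
    F.sec ≫ f = incl F.sub_img := by
  have := F.sec_epi
  calc F.sec ≫ f = F.sec ≫ F.epi ≫ incl F.sub_img := by rw [F.epi_incl]
    _ = _ := by rw [reassoc_of% this]

theorem NormalFactorization.img_sub (F G : NormalFactorization f) : Sub F.img G.img := by
  obtain ⟨k, _⟩ := incl_factor F.sub_img G.sub_img (F.sec ≫ G.epi)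
    (by rw [Category.assoc, G.epi_incl, F.sec_fac])
  exact k

theorem NormalFactorization.img_eq (F G : NormalFactorization f) : F.img = G.img :=
  sub_antisymm (F.img_sub G) (G.img_sub F)

theorem incl_eqToHom {a b b' : C} (h : Sub a b) (e : b = b') :
    incl h ≫ eqToHom e = incl (e ▸ h) := by
  subst e; simp

theorem eqToHom_incl {a a' b : C} (h : Sub a' b) (e : a = a') :
    eqToHom e ≫ incl h = incl (e ▸ h) := by
  subst e; simp

theorem NormalFactorization.epi_eq (F G : NormalFactorization f) :
    F.epi ≫ eqToHom (F.img_eq G) = G.epi := by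
  rw [← cancel_mono (incl G.sub_img), G.epi_incl, Category.assoc, eqToHom_incl, F.epi_incl]

end Fac

/-- The cone `γ * f°`, for a given normal factorization of `f`. -/
def NormalCone.starFac [IsNormalCategory C] (γ : NormalCone C) {d : C} {f : γ.vertex ⟶ d}
    (F : NormalFactorization f) : NormalCone C where
  vertex := F.img
  app c := γ.app c ≫ F.epi
  compat h := by rw [← Category.assoc, γ.compat h]
  normal := by
    obtain ⟨c, hc⟩ := γ.normal
    obtain ⟨G⟩ := IsNormalCategory.factorization (F.sec ≫ inv (γ.app c))
    refine ⟨G.img, ?_⟩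
    have h1 : incl G.sub_img ≫ γ.app c = γ.app G.img := γ.compat _
    have h2 : G.epi ≫ (γ.app G.img ≫ F.epi) = 𝟙 _ := by
      have h3 : G.epi ≫ γ.app G.img = F.sec := by
        rw [← h1, ← Category.assoc, G.epi_incl, Category.assoc, IsIso.inv_hom_id,
          Category.comp_id]
      rw [← Category.assoc, h3, F.sec_epi]
    refine ⟨G.epi, ?_, h2⟩
    have h4 : G.sec ≫ G.epi = 𝟙 _ := G.sec_epi
    calc (γ.app G.img ≫ F.epi) ≫ G.epi
        = (G.sec ≫ G.epi) ≫ (γ.app G.img ≫ F.epi) ≫ G.epi := by rw [h4, Category.id_comp]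
      _ = G.sec ≫ (G.epi ≫ (γ.app G.img ≫ F.epi)) ≫ G.epi := by simp only [Category.assoc]
      _ = 𝟙 _ := by rw [h2, Category.id_comp, h4]

theorem NormalCone.starFac_eq [IsNormalCategory C] (γ : NormalCone C) {d : C}
    {f : γ.vertex ⟶ d} (F G : NormalFactorization f) : γ.starFac F = γ.starFac G :=
  NormalCone.ext' (F.img_eq G) fun c => by
    exact (Category.assoc _ _ _).trans (congrArg (γ.app c ≫ ·) (F.epi_eq G))

/-- The cone `γ * f°`.  It does not depend on the factorization (`NormalCone.starFac_eq`). -/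
noncomputable def NormalCone.star [IsNormalCategory C] (γ : NormalCone C) {d : C}
    (f : γ.vertex ⟶ d) : NormalCone C :=
  γ.starFac (Classical.choice (IsNormalCategory.factorization f))

/-- The multiplication `γ · σ = γ * (σ(c_γ))°` of the semigroup `TC` of normal cones in `C`. -/
noncomputable instance [IsNormalCategory C] : Mul (NormalCone C) :=
  ⟨fun γ σ => γ.star (σ.app γ.vertex)⟩

theorem NormalCone.star_spec [IsNormalCategory C] (γ : NormalCone C) {d : C}
    (f : γ.vertex ⟶ d) : ∃ h : Sub (γ.star f).vertex d,
      ∀ c, (γ.star f).app c ≫ incl h = γ.app c ≫ f := by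
  let F := Classical.choice (IsNormalCategory.factorization f)
  refine ⟨F.sub_img, fun c => ?_⟩
  exact (Category.assoc _ _ _).trans (congrArg (γ.app c ≫ ·) F.epi_incl)

theorem NormalCone.star_injective [IsNormalCategory C] (γ : NormalCone C) {d : C}
    {f g : γ.vertex ⟶ d} (h : γ.star f = γ.star g) : f = g := by
  obtain ⟨c, hc⟩ := γ.normal
  obtain ⟨h1, h2⟩ := γ.star_spec f
  obtain ⟨h3, h4⟩ := γ.star_spec g
  rw [← cancel_epi (γ.app c), ← h2, ← h4]
  clear h2 h4
  revert h1 h3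
  rw [h]
  intro _ _
  rfl

theorem NormalCone.star_id [IsNormalCategory C] (γ : NormalCone C) : γ.star (𝟙 γ.vertex) = γ := by
  let F : NormalFactorization (𝟙 γ.vertex) :=
    { coimg := γ.vertex
      img := γ.vertex
      sub_coimg := sub_refl _
      sub_img := sub_refl _
      e := 𝟙 _
      u := Iso.refl _
      retraction := by rw [incl_refl, Category.id_comp]
      fac := by simp [incl_refl] }
  refine (γ.starFac_eq _ F).trans (NormalCone.ext' rfl fun c => ?_)
  change (γ.app c ≫ 𝟙 _ ≫ 𝟙 _) ≫ 𝟙 _ = _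
  simp

theorem NormalCone.mul_self_of_app [IsNormalCategory C] (γ : NormalCone C)
    (h : γ.app γ.vertex = 𝟙 _) : γ * γ = γ := by
  change γ.star (γ.app γ.vertex) = γ
  rw [h, γ.star_id]

end Normal

/-! ## The normal dual -/

section Dual

variable (C : Type u) [SubobjectCategory C]

/-- A functor from `C` to sets, all of whose values are subsets of the set of normal cones. -/
structure ConeFunctor where
  obj : C → Set (NormalCone C)
  map : ∀ {c d : C}, (c ⟶ d) → obj c → obj d
  map_id : ∀ (c : C) (x : obj c), map (𝟙 c) x = x
  map_comp : ∀ {b c d : C} (f : b ⟶ c) (g : c ⟶ d) (x : obj b), map (f ≫ g) x = map g (map f x)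

variable {C} [IsNormalCategory C]

/-- The set `H(γ; c) = {γ * f° : f ∈ C(c_γ, c)}`. -/
def hSet (γ : NormalCone C) (c : C) : Set (NormalCone C) :=
  {δ | ∃ f : γ.vertex ⟶ c, γ.star f = δ}

/-- The map `H(γ; g) : γ * f° ↦ γ * (f g)°`. -/
noncomputable def hMap (γ : NormalCone C) {c d : C} (g : c ⟶ d) (x : hSet γ c) : hSet γ d :=
  ⟨γ.star (x.2.choose ≫ g), _, rfl⟩

theorem hMap_star (γ : NormalCone C) {c d : C} (g : c ⟶ d) (f : γ.vertex ⟶ c) :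
    hMap γ g ⟨γ.star f, f, rfl⟩ = ⟨γ.star (f ≫ g), _, rfl⟩ := by
  have h : ∃ f' : γ.vertex ⟶ c, γ.star f' = γ.star f := ⟨f, rfl⟩
  have : h.choose = f := γ.star_injective h.choose_spec
  apply Subtype.ext
  change γ.star (h.choose ≫ g) = _
  rw [this]

/-- The map `γ * f° ↦ γ' * (w f)°` from `H(γ; c)` to `H(γ'; c)`. -/
noncomputable def hTrans {γ γ' : NormalCone C} (w : γ'.vertex ⟶ γ.vertex) (c : C)
    (x : hSet γ c) : hSet γ' c :=
  ⟨γ'.star (w ≫ x.2.choose), _, rfl⟩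

theorem hTrans_star {γ γ' : NormalCone C} (w : γ'.vertex ⟶ γ.vertex) {c : C}
    (f : γ.vertex ⟶ c) :
    hTrans w c ⟨γ.star f, f, rfl⟩ = ⟨γ'.star (w ≫ f), _, rfl⟩ := by
  have h : ∃ f' : γ.vertex ⟶ c, γ.star f' = γ.star f := ⟨f, rfl⟩
  have : h.choose = f := γ.star_injective h.choose_spec
  apply Subtype.ext
  change γ'.star (w ≫ h.choose) = _
  rw [this]

/-- The H-functor `H(γ; -)`. -/
noncomputable def hFunctor (γ : NormalCone C) : ConeFunctor C where
  obj := hSet γ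
  map := hMap γ
  map_id := by
    rintro c ⟨_, f, rfl⟩
    rw [hMap_star]
    simp
  map_comp := by
    rintro b c d f g ⟨_, k, rfl⟩
    rw [hMap_star, hMap_star, hMap_star]
    simp

variable (C) in
/-- The normal dual `N*C`: its objects are the H-functors `H(ε; -)` of the idempotents `ε` of the
semigroup `TC`, its morphisms the natural transformations. -/
structure NormalDual extends ConeFunctor C where
  isH : ∃ ε : NormalCone C, IsIdempotentElem ε ∧ toConeFunctor = hFunctor ε

namespace NormalDual

/-- Natural transformations. -/
@[ext]
structure Hom (F G : NormalDual C) where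
  app : ∀ c : C, F.obj c → G.obj c
  naturality : ∀ {c d : C} (g : c ⟶ d) (x : F.obj c), app d (F.map g x) = G.map g (app c x)

instance : Category.{u} (NormalDual C) where
  Hom := Hom
  id F := ⟨fun _ x => x, fun _ _ => rfl⟩
  comp σ τ := ⟨fun c x => τ.app c (σ.app c x), fun g x => by rw [σ.naturality, τ.naturality]⟩

theorem ext_cf {F G : NormalDual C} (h : F.toConeFunctor = G.toConeFunctor) : F = G := by
  cases F; cases G; cases h; rfl

/-- `F` is a subfunctor of `G`. -/
def IsSub (F G : NormalDual C) : Prop :=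
  ∃ h : ∀ c, F.obj c ⊆ G.obj c, ∀ {c d : C} (g : c ⟶ d) (x : F.obj c),
    (F.map g x : NormalCone C) = G.map g ⟨x, h c x.2⟩

/-- The subobjects of an H-functor are those H-functors that are subfunctors of it. -/
instance : SubobjectCategory (NormalDual C) where
  Sub := IsSub
  sub_refl F := ⟨fun _ => subset_rfl, fun _ _ => rfl⟩
  sub_trans := by
    rintro F G H ⟨h, k⟩ ⟨h', k'⟩
    refine ⟨fun c => (h c).trans (h' c), fun {c d} g x => ?_⟩
    rw [k g x, k' g ⟨x, h c x.2⟩]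
  sub_antisymm := by
    rintro ⟨⟨o, m, _, _⟩, _⟩ ⟨⟨o', m', _, _⟩, _⟩ ⟨h, k⟩ ⟨h', _⟩
    apply ext_cf
    have ho : o = o' := funext fun c => Set.Subset.antisymm (h c) (h' c)
    subst ho
    have hm : @m = @m' := by
      funext c d g x
      exact Subtype.ext (k g x)
    subst hm
    rfl
  incl h := ⟨fun c x => ⟨x, h.1 c x.2⟩, fun g x => Subtype.ext (h.2 g x)⟩
  incl_refl _ := rfl
  incl_comp _ _ := rfl
  incl_mono h := ⟨fun σ τ e => by
    apply Hom.ext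
    funext c x
    have := congrArg (fun η : Hom _ _ => (η.app c x : NormalCone C)) e
    exact Subtype.ext this⟩
  incl_factor := by
    rintro F G H h h' σ e
    have key : ∀ c (x : F.obj c), (σ.app c x : NormalCone C) = x := fun c x =>
      congrArg (fun η : Hom _ _ => (η.app c x : NormalCone C)) e
    have hs : ∀ c, F.obj c ⊆ G.obj c := fun c x hx => by
      have := (σ.app c ⟨x, hx⟩).2
      rwa [key] at this
    have hk : ∀ c (x : F.obj c), σ.app c x = ⟨x, hs c x.2⟩ := fun c x => Subtype.ext (key c x)
    refine ⟨⟨hs, fun {c d} g x => ?_⟩, ?_⟩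
    · rw [← key d (F.map g x), σ.naturality, hk]
    · apply Hom.ext
      funext c x
      exact hk c x

/-- The M-set of an H-functor: `M H(ε; -) = M ε`. -/
def mSet (F : NormalDual C) : Set C :=
  {c | ∃ ε : NormalCone C, IsIdempotentElem ε ∧ F.toConeFunctor = hFunctor ε ∧ c ∈ ε.mSet}

/-- The H-functor of an idempotent normal cone, as an object of the normal dual. -/
noncomputable def ofCone (ε : NormalCone C) (h : IsIdempotentElem ε) : NormalDual C :=
  ⟨hFunctor ε, ε, h, rfl⟩

/-- The natural transformation `ε * f° ↦ ε' * (w f)°` from `H(ε; -)` to `H(ε'; -)` determined by a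
morphism `w` from the vertex of `ε'` to the vertex of `ε`. -/
noncomputable def homOf {ε ε' : NormalCone C} (h : IsIdempotentElem ε) (h' : IsIdempotentElem ε')
    (w : ε'.vertex ⟶ ε.vertex) : ofCone ε h ⟶ ofCone ε' h' :=
  Hom.mk (F := ofCone ε h) (G := ofCone ε' h') (fun c => hTrans w c) (by
    rintro c d g ⟨_, f, rfl⟩
    change hTrans w d (hMap ε g ⟨ε.star f, f, rfl⟩) = hMap ε' g (hTrans w c ⟨ε.star f, f, rfl⟩)
    rw [hMap_star, hTrans_star, hTrans_star, hMap_star]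
    simp)

theorem homOf_star {ε ε' : NormalCone C} (h : IsIdempotentElem ε) (h' : IsIdempotentElem ε')
    (w : ε'.vertex ⟶ ε.vertex) {c : C} (f : ε.vertex ⟶ c) :
    Hom.app (homOf h h' w) c ⟨ε.star f, f, rfl⟩ = ⟨ε'.star (w ≫ f), _, rfl⟩ :=
  hTrans_star w f

theorem homOf_id {ε : NormalCone C} (h : IsIdempotentElem ε) : homOf h h (𝟙 _) = 𝟙 _ := by
  apply Hom.ext
  funext c ⟨_, f, hf⟩
  subst hf
  rw [homOf_star]
  simp only [Category.id_comp]
  rfl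

theorem homOf_comp {ε₁ ε₂ ε₃ : NormalCone C} (h₁ : IsIdempotentElem ε₁)
    (h₂ : IsIdempotentElem ε₂) (h₃ : IsIdempotentElem ε₃) (w : ε₂.vertex ⟶ ε₁.vertex)
    (v : ε₃.vertex ⟶ ε₂.vertex) : homOf h₁ h₃ (v ≫ w) = homOf h₁ h₂ w ≫ homOf h₂ h₃ v := by
  apply Hom.ext
  funext c ⟨_, f, hf⟩
  subst hf
  change _ = Hom.app (homOf h₂ h₃ v) c (Hom.app (homOf h₁ h₂ w) c _)
  rw [homOf_star, homOf_star, homOf_star]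
  simp

end NormalDual

end Dual

/-! ## Ideals, local isomorphisms, cross-connections -/

/-- An ideal of a category with subobjects: the full subcategory on a set of objects that contains
every subobject of each of its members. -/
structure CatIdeal (C : Type u) [SubobjectCategory C] where
  carrier : Set C
  down : ∀ {c d : C}, Sub c d → d ∈ carrier → c ∈ carrier

namespace CatIdeal

variable {C : Type u} [SubobjectCategory C] (I : CatIdeal C)

/-- The objects of an ideal. -/
def Obj : Type u := {c : C // c ∈ I.carrier}

instance : Category.{u} I.Obj where
  Hom a b := a.1 ⟶ b.1
  id a := 𝟙 a.1
  comp f g := f ≫ g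

instance : SubobjectCategory I.Obj where
  Sub a b := Sub a.1 b.1
  sub_refl a := sub_refl a.1
  sub_trans h h' := sub_trans h h'
  sub_antisymm h h' := Subtype.ext (sub_antisymm h h')
  incl h := incl (C := C) h
  incl_refl a := incl_refl a.1
  incl_comp h h' := incl_comp (C := C) h h'
  incl_mono h := ⟨fun {c} f g e => (incl_mono (C := C) h).right_cancellation (Z := c.1) f g e⟩
  incl_factor h h' f e := incl_factor (C := C) h h' f e

/-- The inclusion functor `j(I, C)`. -/
def inclusion : I.Obj ⥤ C where
  obj a := a.1
  map f := f

/-- An ideal of a normal category is a normal category. -/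
instance [IsNormalCategory C] : IsNormalCategory I.Obj where
  factorization {c d} f := by
    obtain ⟨F⟩ := IsNormalCategory.factorization (C := C) (c := c.1) (d := d.1) f
    exact ⟨{
      coimg := ⟨F.coimg, I.down F.sub_coimg c.2⟩
      img := ⟨F.img, I.down F.sub_img d.2⟩
      sub_coimg := F.sub_coimg
      sub_img := F.sub_img
      e := F.e
      u := ⟨F.u.hom, F.u.inv, F.u.hom_inv_id, F.u.inv_hom_id⟩
      retraction := F.retraction
      fac := F.fac }⟩
  splits h := IsNormalCategory.splits (C := C) h
  exists_cone c := by
    obtain ⟨c, hc⟩ := c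
    obtain ⟨γ, rfl, hγ⟩ := IsNormalCategory.exists_cone (C := C) c
    refine ⟨⟨⟨⟨γ.vertex, hc⟩, fun d => γ.app d.1, fun h => γ.compat h⟩, ⟨γ.vertex, hc⟩, ?_⟩,
      rfl, hγ⟩
    exact ⟨𝟙 γ.vertex, by
      change γ.app γ.vertex ≫ 𝟙 _ = 𝟙 _
      rw [hγ, Category.comp_id], by
      change 𝟙 _ ≫ γ.app γ.vertex = 𝟙 _
      rw [hγ, Category.comp_id]⟩

end CatIdeal

section Connection

variable {C D : Type u} [SubobjectCategory C] [SubobjectCategory D]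

/-- A local isomorphism: inclusion preserving, fully faithful, and an isomorphism of each
principal ideal `⟨c⟩` onto `⟨F c⟩`.  (A principal ideal is the full subcategory of the subobjects of
its generator, so for a fully faithful functor the last condition says that the functor is a
bijection on objects, from the subobjects of `c` to those of `F c`.) -/
structure IsLocalIso (F : C ⥤ D) : Prop where
  map_incl : ∀ {c d : C} (h : Sub c d), ∃ k : Sub (F.obj c) (F.obj d), F.map (incl h) = incl k
  full : F.Full
  faithful : F.Faithful
  bijOn : ∀ c : C, Set.BijOn F.obj {a | Sub a c} {b | Sub b (F.obj c)}

variable [IsNormalCategory C] [IsNormalCategory D]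

/-- `(D, C; Γ)` is a cross-connection from `D` to `C`. -/
structure IsCrossConnection (Γ : D ⥤ NormalDual C) : Prop where
  localIso : IsLocalIso Γ
  exists_mem : ∀ c : C, ∃ d : D, c ∈ (Γ.obj d).mSet

/-- `Γ(f, g) : Γ(c, d) → Γ(c', d')`, for the bifunctor `Γ(c, d) = Γ(d)(c)` on `C × D`. -/
def leftMap (Γ : D ⥤ NormalDual C) {c c' : C} {d d' : D} (f : c ⟶ c') (g : d ⟶ d')
    (x : (Γ.obj d).obj c) : (Γ.obj d').obj c' :=
  NormalDual.Hom.app (Γ.map g) c' ((Γ.obj d).map f x)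

/-- `Δ(f, g) : Δ(c, d) → Δ(c', d')`, for the bifunctor `Δ(c, d) = Δ(c)(d)` on `C × D`. -/
def rightMap (Δ : C ⥤ NormalDual D) {c c' : C} {d d' : D} (f : c ⟶ c') (g : d ⟶ d')
    (x : (Δ.obj c).obj d) : (Δ.obj c').obj d' :=
  NormalDual.Hom.app (Δ.map f) d' ((Δ.obj c).map g x)

/-- `Δ` is a dual cross-connection of `Γ`, with duality `χ`: both are cross-connections,
`c ∈ M Γ(d)` iff `d ∈ M Δ(c)`, and `χ` is a natural isomorphism from `Γ(-, -)` to `Δ(-, -)` such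
that, whenever `c ∈ M Γ(d)`, it takes the idempotent cone `γ(c, d)` (the idempotent cone `γ` with
vertex `c` and `Γ(d) = H(γ; -)`) to the idempotent cone `δ(c, d)` (the idempotent cone `δ` with
vertex `d` and `Δ(c) = H(δ; -)`). -/
structure Duality (Γ : D ⥤ NormalDual C) (Δ : C ⥤ NormalDual D) where
  isCross : IsCrossConnection Γ
  isCross_dual : IsCrossConnection Δ
  mem_iff : ∀ (c : C) (d : D), c ∈ (Γ.obj d).mSet ↔ d ∈ (Δ.obj c).mSet
  χ : ∀ (c : C) (d : D), (Γ.obj d).obj c ≃ (Δ.obj c).obj d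
  naturality : ∀ {c c' : C} {d d' : D} (f : c ⟶ c') (g : d ⟶ d') (x : (Γ.obj d).obj c),
    χ c' d' (leftMap Γ f g x) = rightMap Δ f g (χ c d x)
  unit : ∀ (c : C) (d : D) (x : (Γ.obj d).obj c) (y : (Δ.obj c).obj d),
    IsIdempotentElem x.1 → x.1.vertex = c → (Γ.obj d).toConeFunctor = hFunctor x.1 →
    IsIdempotentElem y.1 → y.1.vertex = d → (Δ.obj c).toConeFunctor = hFunctor y.1 →
    χ c d x = y

/-- The set of linked pairs `(γ, δ)`, in `TC × (TD)ᵒᵖ`.  With the multiplication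
`(γ, δ) ∘ (γ', δ') = (γ · γ', δ' · δ)` of `TC × (TD)ᵒᵖ` it is the cross-connection semigroup. -/
def linkedPairs {Γ : D ⥤ NormalDual C} {Δ : C ⥤ NormalDual D} (χ : Duality Γ Δ) :
    Set (NormalCone C × (NormalCone D)ᵐᵒᵖ) :=
  {p | ∃ (c : C) (d : D) (h : p.1 ∈ (Γ.obj d).obj c), p.2.unop = (χ.χ c d ⟨p.1, h⟩).1}

end Connection

/-! ## Singular transformations -/

/-- The semigroup `Sing(X)` of singular transformations: the maps from `X` to itself that are
neither injective nor surjective, i.e. whose image is a proper subset and whose kernel is a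
non-identity partition.  For finite `X` these are the non-invertible maps (`sing_iff_of_finite`);
for infinite `X` the non-invertible maps are not closed under composition. -/
@[ext]
structure Sing (X : Type u) where
  toFun : X → X
  not_injective : ¬ Function.Injective toFun
  not_surjective : ¬ Function.Surjective toFun

theorem sing_iff_of_finite {X : Type u} [Finite X] (a : X → X) :
    ¬ Function.Bijective a ↔ ¬ Function.Injective a ∧ ¬ Function.Surjective a := by
  simp [Function.Bijective, Finite.injective_iff_surjective]

/-- Maps are composed from left to right. -/
instance (X : Type u) : Semigroup (Sing X) where
  mul a b := ⟨fun x => b.toFun (a.toFun x),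
    fun h => a.not_injective (Function.Injective.of_comp (f := b.toFun) h),
    fun h => b.not_surjective (Function.Surjective.of_comp (g := a.toFun) h)⟩
  mul_assoc _ _ _ := rfl

/-! ## The powerset category -/

/-- The objects of the powerset category: the non-empty proper subsets of `X`. -/
@[ext]
structure Pow (X : Type u) where
  carrier : Set X
  nonempty : carrier.Nonempty
  ne_univ : carrier ≠ Set.univ

namespace Pow

variable {X : Type u}

instance : Category.{u} (Pow X) where
  Hom A B := A.carrier → B.carrier
  id A := fun x => x
  comp f g := fun x => g (f x)

instance : SubobjectCategory (Pow X) where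
  Sub A B := A.carrier ⊆ B.carrier
  sub_refl _ := subset_rfl
  sub_trans h h' := h.trans h'
  sub_antisymm h h' := Pow.ext (Set.Subset.antisymm h h')
  incl h := fun x => ⟨x, h x.2⟩
  incl_refl _ := rfl
  incl_comp _ _ := rfl
  incl_mono h := ⟨fun f g e => by
    funext x
    have k := congrArg Subtype.val (congrFun e x)
    exact Subtype.ext k⟩
  incl_factor h h' f e := by
    have key : ∀ x, (f x).1 = x.1 := fun x => congrArg Subtype.val (congrFun e x)
    refine ⟨fun x hx => ?_, funext fun x => Subtype.ext (key x)⟩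
    have k := (f ⟨x, hx⟩).2
    rwa [key] at k

/-- The image of a singular transformation. -/
def im (a : Sing X) : Pow X where
  carrier := Set.range a.toFun
  nonempty := by
    by_contra h
    rw [Set.not_nonempty_iff_eq_empty, Set.range_eq_empty_iff] at h
    exact a.not_injective fun x => h.elim x
  ne_univ h := a.not_surjective (Set.range_eq_univ.mp h)

/-- The cone with vertex `Im a` whose component at `A` is the restriction of `a` to `A`. -/
def rhoCone (a : Sing X) : SubCone (Pow X) where
  vertex := im a
  app _ := fun x => ⟨a.toFun x, x, rfl⟩
  compat _ := rfl

/-- The normal cone `ρ^a` determined by the transformation `a`. -/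
def rho (a : Sing X) : NormalCone (Pow X) where
  toSubCone := rhoCone a
  normal := by
    let s : (im a).carrier → X := fun y => y.2.choose
    have hs : ∀ y, a.toFun (s y) = y := fun y => y.2.choose_spec
    let B : Pow X :=
      { carrier := Set.range s
        nonempty := by
          obtain ⟨y, hy⟩ := (im a).nonempty
          exact ⟨s ⟨y, hy⟩, _, rfl⟩
        ne_univ := fun h => a.not_injective fun x y hxy => by
          obtain ⟨x', rfl⟩ := (h ▸ Set.mem_univ x : x ∈ Set.range s)
          obtain ⟨y', rfl⟩ := (h ▸ Set.mem_univ y : y ∈ Set.range s)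
          rw [hs, hs] at hxy
          rw [Subtype.ext hxy] }
    refine ⟨B, fun y => ⟨s y, y, rfl⟩, ?_, ?_⟩
    · funext ⟨x, y, hy⟩
      subst hy
      exact Subtype.ext (congrArg s (Subtype.ext (hs y)))
    · funext y
      exact Subtype.ext (hs y)

theorem rho_app_vertex (a : Sing X) (h : IsIdempotentElem a) :
    (rho a).app (rho a).vertex = 𝟙 _ := by
  funext ⟨x, y, hy⟩
  subst hy
  exact Subtype.ext (congrArg (fun b : Sing X => b.toFun y) h)

theorem exists_retraction (A : Pow X) : ∃ f : X → A.carrier, ∀ x : A.carrier, f x = x := by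
  classical
  obtain ⟨a, ha⟩ := A.nonempty
  exact ⟨fun x => if h : x ∈ A.carrier then ⟨x, h⟩ else ⟨a, ha⟩, fun x => by simp⟩

instance : IsNormalCategory (Pow X) where
  factorization {A B} f := by
    let g : A.carrier → X := fun x => f x
    let I : Pow X :=
      { carrier := Set.range g
        nonempty := A.nonempty.elim fun x hx => ⟨g ⟨x, hx⟩, _, rfl⟩
        ne_univ := fun h => B.ne_univ (Set.eq_univ_of_univ_subset (h ▸ by
          rintro _ ⟨x, rfl⟩
          exact (f x).2)) }
    let s : I.carrier → A.carrier := fun y => y.2.choose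
    have hs : ∀ y, g (s y) = y := fun y => y.2.choose_spec
    let J : Pow X :=
      { carrier := Set.range fun y => (s y : X)
        nonempty := I.nonempty.elim fun x hx => ⟨s ⟨x, hx⟩, _, rfl⟩
        ne_univ := fun h => A.ne_univ (Set.eq_univ_of_univ_subset (h ▸ by
          rintro _ ⟨x, rfl⟩
          exact (s x).2)) }
    have hJ : J.carrier ⊆ A.carrier := by
      rintro _ ⟨x, rfl⟩
      exact (s x).2
    exact ⟨{
      coimg := J
      img := I
      sub_coimg := hJ
      sub_img := by
        rintro _ ⟨x, rfl⟩
        exact (f x).2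
      e := fun x => ⟨s ⟨g x, x, rfl⟩, _, rfl⟩
      u :=
        { hom := fun x => ⟨g ⟨x, hJ x.2⟩, _, rfl⟩
          inv := fun y => ⟨s y, y, rfl⟩
          hom_inv_id := by
            funext ⟨x, y, hy⟩
            subst hy
            exact Subtype.ext (congrArg (fun z => (s z : X)) (Subtype.ext (hs y)))
          inv_hom_id := by
            funext y
            exact Subtype.ext (hs y) }
      retraction := by
        funext ⟨x, y, hy⟩
        subst hy
        exact Subtype.ext (congrArg (fun z => (s z : X)) (Subtype.ext (hs y)))
      fac := by
        funext x
        exact Subtype.ext (hs ⟨g x, x, rfl⟩) }⟩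
  splits {A _} _ := by
    obtain ⟨f, hf⟩ := A.exists_retraction
    exact ⟨fun x => f x, funext fun x => hf x⟩
  exists_cone A := by
    obtain ⟨f, hf⟩ := A.exists_retraction
    have h : (fun x : A.carrier => f x) = fun x => x := funext hf
    exact ⟨⟨⟨A, fun B x => f x, fun _ => rfl⟩, A, by
      change IsIso (C := Pow X) (X := A) (Y := A) fun x : A.carrier => f x
      rw [h]
      exact inferInstanceAs (IsIso (𝟙 A))⟩, rfl, h⟩

end Pow

/-! ## The category of partitions -/

/-- The objects of the category of partitions: the non-identity partitions `π` of `X`, given as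
equivalence relations; the blocks of the partition `p` are the elements of `Quotient p.rel`.
Its object is written `π̄` below. -/
@[ext]
structure Partn (X : Type u) where
  rel : Setoid X
  ne_bot : rel ≠ ⊥

namespace Partn

variable {X : Type u}

/-- A morphism from `π̄₁` to `π̄₂` is the map `η* : α ↦ η α` from `π̄₁` to `π̄₂` given by a function
`η` from `π₂` to `π₁`.  It is represented by `η`; by `star_injective` and `star_comp` below,
`η ↦ η*` is injective and compatible with the composition. -/
instance : Category.{u} (Partn X) where
  Hom p q := Quotient q.rel → Quotient p.rel
  id _ := fun c => c
  comp f g := fun c => f (g c)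

/-- The map `η*`. -/
def star {p q : Partn X} (η : p ⟶ q) (α : Quotient p.rel → X) : Quotient q.rel → X :=
  fun c => α (η c)

theorem star_injective [Nontrivial X] {p q : Partn X} {η η' : p ⟶ q} (h : star η = star η') :
    η = η' := by
  classical
  obtain ⟨x, y, hxy⟩ := exists_pair_ne X
  funext c
  by_contra hc
  have := congrFun (congrFun h fun d => if d = η c then x else y) c
  simp [star, Ne.symm hc, hxy] at this

theorem star_comp {p q r : Partn X} (η : p ⟶ q) (μ : q ⟶ r) (α : Quotient p.rel → X) :
    star (η ≫ μ) α = star μ (star η α) := rfl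

/-- `π̄₁ ≤ π̄₂` iff every block of `π₂` is contained in a block of `π₁`; the inclusion morphism is
then `ν*`, where `ν` takes each block of `π₂` to the block of `π₁` that contains it. -/
instance : SubobjectCategory (Partn X) where
  Sub p q := q.rel ≤ p.rel
  sub_refl _ := le_rfl
  sub_trans h h' := h'.trans h
  sub_antisymm h h' := Partn.ext (le_antisymm h' h)
  incl h := Quotient.map id fun _ _ k => h k
  incl_refl p := by
    funext c
    induction c using Quotient.inductionOn
    rfl
  incl_comp h h' := by
    funext c
    induction c using Quotient.inductionOn
    rfl
  incl_mono h := ⟨fun f g e => by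
    funext c
    induction c using Quotient.inductionOn with
    | h x => exact congrFun e (Quotient.mk _ x)⟩
  incl_factor {p q r} h h' f e := by
    have key : ∀ x : X, f (Quotient.mk q.rel x) = Quotient.mk p.rel x := fun x =>
      congrFun e (Quotient.mk r.rel x)
    refine ⟨fun x y hxy => ?_, ?_⟩
    · apply Quotient.exact
      rw [← key x, ← key y, Quotient.sound hxy]
    · funext c
      induction c using Quotient.inductionOn with
      | h x => exact key x

theorem nonempty (p : Partn X) : Nonempty X := by
  by_contra h
  rw [not_nonempty_iff] at h
  exact p.ne_bot (Setoid.ext fun x => h.elim x)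

theorem ne_bot_of_le {p : Partn X} {s : Setoid X} (h : p.rel ≤ s) : s ≠ ⊥ := fun e =>
  p.ne_bot (le_bot_iff.mp (e ▸ h))

instance : IsNormalCategory (Partn X) where
  factorization {p q} η := by
    classical
    let m : (s : Setoid X) → X → Quotient s := fun s => Quotient.mk s
    let g : X → Quotient p.rel := fun x => η (m q.rel x)
    have hg : ∀ c : Quotient q.rel, ∃ x, g x = η c := fun c => by
      induction c using Quotient.inductionOn with
      | h x => exact ⟨x, rfl⟩
    obtain ⟨x₀⟩ := p.nonempty
    let r : Quotient p.rel → Quotient p.rel := fun c => if ∃ x, g x = c then c else g x₀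
    have hr : ∀ c, ∃ x, g x = r c := fun c => by
      by_cases h : ∃ x, g x = c
      · simpa only [r, if_pos h] using h
      · exact ⟨x₀, by simp only [r, if_neg h]⟩
    have hrg : ∀ x, r (g x) = g x := fun x => if_pos ⟨x, rfl⟩
    let P : Partn X := ⟨Setoid.ker fun x => r (m p.rel x),
      ne_bot_of_le (p := p) fun x y h => congrArg r (Quotient.sound h)⟩
    have hP : Sub P p := fun x y h => congrArg r (Quotient.sound h)
    let Q : Partn X := ⟨Setoid.ker g,
      ne_bot_of_le (p := q) fun x y h => congrArg η (Quotient.sound h)⟩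
    have hQ : Sub Q q := fun x y h => congrArg η (Quotient.sound h)
    -- `z` is induced by `r`, and `n` is the projection of blocks
    let z : Quotient P.rel → Quotient p.rel := Quotient.lift (fun x => r (m p.rel x)) fun _ _ h => h
    let n : Quotient p.rel → Quotient P.rel := incl hP
    have hzn : ∀ c, z (n c) = r c := fun c => by
      induction c using Quotient.inductionOn
      rfl
    have hz : Function.Injective z := fun c d => by
      induction c using Quotient.inductionOn
      induction d using Quotient.inductionOn
      exact fun h => Quotient.sound h
    have hzr : ∀ c, r (z c) = z c := fun c => by
      induction c using Quotient.inductionOn with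
      | h x =>
        obtain ⟨y, hy⟩ := hr (m p.rel x)
        change r (r (m p.rel x)) = r (m p.rel x)
        rw [← hy, hrg]
    let gq : Quotient Q.rel → Quotient p.rel := Quotient.lift g fun _ _ h => h
    have hgq : Function.Injective gq := fun c d => by
      induction c using Quotient.inductionOn
      induction d using Quotient.inductionOn
      exact fun h => Quotient.sound h
    have hrgq : ∀ c, r (gq c) = gq c := fun c => by
      induction c using Quotient.inductionOn with
      | h x => exact hrg x
    have hinv : ∀ c : Quotient P.rel, ∃ d : Quotient Q.rel, gq d = z c := fun c => by
      induction c using Quotient.inductionOn with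
      | h x =>
        obtain ⟨y, hy⟩ := hr (m p.rel x)
        exact ⟨m _ y, hy⟩
    exact ⟨{
      coimg := P
      img := Q
      sub_coimg := hP
      sub_img := hQ
      e := z
      u :=
        { hom := fun c => n (gq c)
          inv := fun c => (hinv c).choose
          hom_inv_id := funext fun c => hz (by
            change z (n (gq (hinv c).choose)) = z c
            rw [hzn, hrgq, (hinv c).choose_spec])
          inv_hom_id := funext fun c => hgq (by
            change gq (hinv (n (gq c))).choose = gq c
            rw [(hinv _).choose_spec, hzn, hrgq]) }
      retraction := funext fun c => hz (by
        change z (n (z c)) = z c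
        rw [hzn, hzr])
      fac := funext fun c => by
        induction c using Quotient.inductionOn with
        | h x =>
          change z (n (g x)) = g x
          rw [hzn, hrg] }⟩
  splits _ :=
    ⟨fun c => Quotient.mk _ c.out, funext fun c => c.out_eq⟩
  exists_cone p := by
    have h : (fun c : Quotient p.rel => Quotient.mk p.rel c.out) = fun c => c :=
      funext fun c => c.out_eq
    exact ⟨⟨⟨p, fun q c => Quotient.mk q.rel c.out, fun _ => rfl⟩, p, by
      change IsIso (C := Partn X) (X := p) (Y := p) fun c => Quotient.mk p.rel c.out
      rw [h]
      exact inferInstanceAs (IsIso (𝟙 p))⟩, rfl, h⟩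

/-- The partition `π_a` determined by a singular transformation: `x` and `y` are in the same block
iff `a` takes the same value at them. -/
def ker (a : Sing X) : Partn X where
  rel := Setoid.ker a.toFun
  ne_bot h := a.not_injective ((Setoid.injective_iff_ker_bot _).mpr h)

variable (I : CatIdeal (Partn X))

/-- The cone `σ^a` with vertex `π̄_a` whose component at `π̄` is given by the map
`[x] ↦ [x a]` from `π_a` to `π`. -/
def sigmaCone (a : Sing X) (h : ker a ∈ I.carrier) : SubCone I.Obj where
  vertex := ⟨ker a, h⟩
  app p := Quotient.lift (fun x => Quotient.mk p.1.rel (a.toFun x)) fun _ _ k =>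
    congrArg (Quotient.mk p.1.rel) k
  compat k := by
    funext c
    induction c using Quotient.inductionOn
    rfl

theorem sigmaCone_app_vertex (e : Sing X) (h : ker e ∈ I.carrier) (he : IsIdempotentElem e) :
    (sigmaCone I e h).app (sigmaCone I e h).vertex = 𝟙 _ := by
  funext c
  induction c using Quotient.inductionOn with
  | h x => exact Quotient.sound (congrArg (fun b : Sing X => b.toFun x) he)

/-- The normal cone `σ^e` determined by an idempotent `e`. -/
def sigma (e : Sing X) (h : ker e ∈ I.carrier) (he : IsIdempotentElem e) : NormalCone I.Obj where
  toSubCone := sigmaCone I e h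
  normal := ⟨(sigmaCone I e h).vertex, by
    rw [sigmaCone_app_vertex I e h he]
    infer_instance⟩

theorem sigma_idem (e : Sing X) (h : ker e ∈ I.carrier) (he : IsIdempotentElem e) :
    IsIdempotentElem (sigma I e h he) :=
  NormalCone.mul_self_of_app _ (sigmaCone_app_vertex I e h he)

/-! ### The identification of the category of partitions with the normal dual of `Pow X` -/

/-- An idempotent `e` with `π_e = p`: it takes each element to a chosen element of its block. -/
noncomputable def idem (p : Partn X) : Sing X where
  toFun x := (Quotient.mk p.rel x).out
  not_injective h := p.ne_bot (Setoid.ext fun x y =>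
    ⟨fun k => h (congrArg Quotient.out (Quotient.sound k)), fun k => by
      rw [show x = y from k]⟩)
  not_surjective h := p.ne_bot (by
    have key : ∀ y : X, (Quotient.mk p.rel y).out = y := fun y => by
      obtain ⟨x, rfl⟩ := h y
      exact congrArg Quotient.out (Quotient.out_eq _)
    exact Setoid.ext fun x y => ⟨fun k => by
      have := congrArg Quotient.out (Quotient.sound k)
      rwa [key, key] at this, fun k => by rw [show x = y from k]⟩)

theorem idem_idem (p : Partn X) : IsIdempotentElem p.idem :=
  Sing.ext (funext fun _ => congrArg Quotient.out (Quotient.out_eq _))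

theorem rho_idem (p : Partn X) : IsIdempotentElem (Pow.rho p.idem) :=
  NormalCone.mul_self_of_app _ (Pow.rho_app_vertex _ p.idem_idem)

/-- The map from `Im f` to `Im e` determined by a function `η` from the blocks of `q = π_f` to the
blocks of `p = π_e`, where `e` and `f` are the chosen idempotents. -/
noncomputable def between {p q : Partn X} (η : p ⟶ q) :
    (Pow.rho q.idem).vertex ⟶ (Pow.rho p.idem).vertex :=
  fun y => ⟨(η (Quotient.mk q.rel y)).out, by
    obtain ⟨x, hx⟩ := (η (Quotient.mk q.rel y)).exists_rep
    exact ⟨x, congrArg Quotient.out hx⟩⟩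

theorem between_id (p : Partn X) : between (𝟙 p) = 𝟙 _ := by
  funext ⟨x, y, hy⟩
  subst hy
  exact Subtype.ext (congrArg Quotient.out (Quotient.out_eq _))

theorem between_comp {p q r : Partn X} (η : p ⟶ q) (μ : q ⟶ r) :
    between (η ≫ μ) = between μ ≫ between η := by
  funext y
  exact Subtype.ext (congrArg (fun c => (η c).out) (Quotient.out_eq _).symm)

variable (X) in
/-- The functor `Π(X) ⥤ N*𝒫(X)` through which `Π(X)` is identified with the normal dual of
`𝒫(X)`: it takes `π̄` to `H(e; -)`, where `e` is an idempotent with `π_e = π`, and `η*` to the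
natural transformation `a ↦ w a`, where `w : Im f → Im e` is the map induced by `η`. -/
noncomputable def toDual : Partn X ⥤ NormalDual (Pow X) where
  obj p := NormalDual.ofCone (Pow.rho p.idem) p.rho_idem
  map {p q} η := NormalDual.homOf p.rho_idem q.rho_idem (between η)
  map_id p := by rw [between_id, NormalDual.homOf_id]
  map_comp {p q r} η μ := by
    rw [between_comp, NormalDual.homOf_comp p.rho_idem q.rho_idem r.rho_idem]

/-- `I` is a total ideal: for every object `A` of `𝒫(X)` there is `π̄` in `I` such that `A` belongs to
the M-set of the corresponding H-functor. -/
def IsTotal : Prop := ∀ A : Pow X, ∃ p ∈ I.carrier, A ∈ ((toDual X).obj p).mSet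

/-- The inclusion functor `j(I, Π(X))`, as a functor from `I` to the normal dual of `𝒫(X)`. -/
noncomputable def gamma : I.Obj ⥤ NormalDual (Pow X) := I.inclusion ⋙ toDual X

/-- The morphism from `π̄_{e'}` to `π̄_e` in `I` given by the map `[x] ↦ [(x e) f]` from `π_e` to
`π_{e'}`. -/
def hat {e e' : Sing X} (h : ker e ∈ I.carrier) (he : IsIdempotentElem e)
    (h' : ker e' ∈ I.carrier) (he' : IsIdempotentElem e') (f : Pow.im e ⟶ Pow.im e') :
    (sigma I e' h' he').vertex ⟶ (sigma I e h he).vertex :=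
  Quotient.lift (fun x => Quotient.mk (ker e').rel (f ⟨e.toFun x, x, rfl⟩).1) fun x y k => by
    have : (⟨e.toFun x, x, rfl⟩ : (Pow.im e).carrier) = ⟨e.toFun y, y, rfl⟩ := Subtype.ext k
    change Quotient.mk _ (f ⟨e.toFun x, x, rfl⟩).1 = Quotient.mk _ (f ⟨e.toFun y, y, rfl⟩).1
    rw [this]

/-- `Δ` is the identity functor of `𝒫(X)`, when the H-functors `H(σ^e; -)` in `N*I` are identified with
the sets `Im e`, and the natural transformations between them with the maps between these sets:
`Δ(Im e) = H(σ^e; -)` for each idempotent `e` with `π̄_e` in `I`, and for `f : Im e → Im e'`, `Δ(f)` is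
the natural transformation `σ^e * g° ↦ σ^{e'} * (f̂ g)°`, where `f̂ : π̄_{e'} → π̄_e` is given by `f`. -/
structure IsIdentity (Δ : Pow X ⥤ NormalDual I.Obj) : Prop where
  obj : ∀ (e : Sing X) (h : ker e ∈ I.carrier) (he : IsIdempotentElem e),
    Δ.obj (Pow.im e) = NormalDual.ofCone (sigma I e h he) (sigma_idem I e h he)
  map : ∀ (e e' : Sing X) (h : ker e ∈ I.carrier) (he : IsIdempotentElem e)
    (h' : ker e' ∈ I.carrier) (he' : IsIdempotentElem e') (f : Pow.im e ⟶ Pow.im e')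
    (p : I.Obj) (g : (sigma I e h he).vertex ⟶ p)
    (hg : (sigma I e h he).star g ∈ (Δ.obj (Pow.im e)).obj p),
    (NormalDual.Hom.app (Δ.map f) p ⟨_, hg⟩ : NormalCone I.Obj) =
      (sigma I e' h' he').star (hat I h he h' he' f ≫ g)

/-- The subsemigroup `{a ∈ Sing(X) : π̄_a ∈ I}` of `Sing(X)`. -/
def singSub : Subsemigroup (Sing X) where
  carrier := {a | ker a ∈ I.carrier}
  mul_mem' {a b} ha _ := I.down (d := ker a) (fun _ _ k => congrArg b.toFun k) ha

end Partn

/-- Regular semigroups. -/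
def IsRegularSemigroup (S : Type u) [Semigroup S] : Prop := ∀ a : S, ∃ b : S, a * b * a = a

/-- Right reductive semigroups: the right regular representation, which takes `a` to the right
translation `x ↦ x a`, is injective. -/
def IsRightReductive (S : Type u) [Semigroup S] : Prop :=
  Function.Injective fun (a : S) (x : S) => x * a

end CrossConnection

/-! Everything reduces to functions `h` from the blocks of a partition `p` to a subset `A`. Such an
`h` gives the singular map `toSing h : x ↦ h [x]`. If `π_e = p`, the elements of `H(ρ^e; A)` are
exactly the cones `ρ^a` with `a = toSing h` (`dualEquiv_val`). If `e` is an idempotent with image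
`A` and `π̄_e` in `I`, the elements of `H(σ^e; p)` are exactly the cones `σ^a` for the same maps `a`
(`Retraction.coneEquiv_val`). So `ρ^a ↦ σ^a` is a bijection. It is natural because on both sides a
pair of morphisms acts by `h ↦ f ∘ h ∘ g`, and the M-set conditions agree because both say that `A`
is a transversal of `p`. Totality provides, for each `A`, an idempotent onto `A` with kernel in `I`;
it also makes every `σ^a` normal.

Natural transformations and inclusions between H-functors are governed by maps of vertices (a Yoneda
argument: evaluate at the generating cone), which makes both functors local isomorphisms.

For uniqueness, let any duality be given and let `y` be its idempotent cone `δ(A, p)`. Comparing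
values on constant functions into `{x}`, for `x ∈ A`, with those for a transversal of `q` through
`x` shows that `y` sends the block of `x` to the block of `x` in every `q` (`IsUnitCone.app_mk`).
This determines `y`, hence `χ`, hence `Δ`. The linked pairs are then the pairs `(ρ^a, σ^a)`. -/

namespace CrossConnection

open SubobjectCategory

/-! ### Equality of cones in a normal category -/

section NormalCone

variable {C : Type u} [SubobjectCategory C]

/-- At an object where `γ` is invertible, the inverse component followed by the component of `δ`
factors one inclusion through the other, so the vertices are comparable in both directions.
Inclusions are monomorphisms, so the components agree too. -/
theorem NormalCone.eq_of_comp_incl {γ δ : NormalCone C} {d : C} (h : Sub γ.vertex d)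
    (k : Sub δ.vertex d) (e : ∀ c, γ.app c ≫ incl h = δ.app c ≫ incl k) : γ = δ := by
  have key : ∀ {γ δ : NormalCone C} (h : Sub γ.vertex d) (k : Sub δ.vertex d),
      (∀ c, γ.app c ≫ incl h = δ.app c ≫ incl k) → Sub γ.vertex δ.vertex := by
    intro γ δ h k e
    obtain ⟨c, hc⟩ := γ.normal
    obtain ⟨s, _⟩ := incl_factor h k (inv (γ.app c) ≫ δ.app c) (by
      rw [Category.assoc, ← e, IsIso.inv_hom_id_assoc])
    exact s
  have hv : γ.vertex = δ.vertex := sub_antisymm (key h k e) (key k h fun c => (e c).symm)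
  refine NormalCone.ext' hv fun c => ?_
  rw [← cancel_mono (incl k), Category.assoc, eqToHom_incl, e]

variable [IsNormalCategory C]

/-- This computes `γ * f°` without a normal factorization of `f`: it suffices to compare cones after
including their vertices in the codomain. -/
theorem NormalCone.star_eq_of_comp_incl {γ δ : NormalCone C} {d : C} {f : γ.vertex ⟶ d}
    (h : Sub δ.vertex d) (e : ∀ c, δ.app c ≫ incl h = γ.app c ≫ f) : γ.star f = δ := by
  obtain ⟨k, hk⟩ := γ.star_spec f
  exact NormalCone.eq_of_comp_incl k h fun c => by rw [hk, e]

theorem NormalCone.star_eq_star_iff {γ δ : NormalCone C} {d : C} {f : γ.vertex ⟶ d}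
    {g : δ.vertex ⟶ d} : γ.star f = δ.star g ↔ ∀ c, γ.app c ≫ f = δ.app c ≫ g := by
  obtain ⟨h, e⟩ := γ.star_spec f
  obtain ⟨h', e'⟩ := δ.star_spec g
  constructor
  · intro k c
    rw [← e, ← e']
    clear e e'
    revert h h'
    rw [k]
    intro _ _
    rfl
  · intro k
    exact NormalCone.eq_of_comp_incl h h' fun c => by rw [e, e', k]

theorem NormalCone.star_eq_iff {γ δ : NormalCone C} {f : γ.vertex ⟶ δ.vertex} :
    γ.star f = δ ↔ ∀ c, γ.app c ≫ f = δ.app c := by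
  have h := NormalCone.star_eq_star_iff (f := f) (g := 𝟙 δ.vertex)
  rw [δ.star_id] at h
  simpa using h

theorem NormalCone.isIdempotentElem_iff {γ : NormalCone C} :
    IsIdempotentElem γ ↔ γ.app γ.vertex = 𝟙 _ := by
  refine ⟨fun h => γ.star_injective ?_, γ.mul_self_of_app⟩
  rw [γ.star_id]
  exact h

/-- The bijection from `C(c_γ, c)` to `H(γ; c)`. -/
noncomputable def hEquiv (γ : NormalCone C) (c : C) : (γ.vertex ⟶ c) ≃ hSet γ c :=
  Equiv.ofBijective (fun f => ⟨γ.star f, f, rfl⟩)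
    ⟨fun _ _ h => γ.star_injective (congrArg Subtype.val h), by
      rintro ⟨_, f, rfl⟩
      exact ⟨f, rfl⟩⟩

end NormalCone

/-! ### H-functors and their natural transformations -/

namespace NormalDual

variable {C : Type u} [SubobjectCategory C] [IsNormalCategory C]

theorem exists_eq_ofCone (F : NormalDual C) :
    ∃ (ε : NormalCone C) (h : IsIdempotentElem ε), F = ofCone ε h := by
  obtain ⟨ε, h, e⟩ := F.isH
  exact ⟨ε, h, ext_cf e⟩

section Idem

variable {ε ε' : NormalCone C} {h : IsIdempotentElem ε} {h' : IsIdempotentElem ε'}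

/-- When `ε` is `ε'` followed by `w`, the cones `ε * f°` and `ε' * (w f)°` coincide, as both are the
image part of the same family of morphisms. -/
theorem sub_ofCone (w : ε'.vertex ⟶ ε.vertex) (hw : ∀ c, ε'.app c ≫ w = ε.app c) :
    Sub (ofCone ε h) (ofCone ε' h') := by
  have key : ∀ {c : C} (f : ε.vertex ⟶ c), ε'.star (w ≫ f) = ε.star f := fun f =>
    NormalCone.star_eq_star_iff.mpr fun c => by rw [← Category.assoc, hw]
  refine ⟨?_, ?_⟩
  · rintro c _ ⟨f, rfl⟩
    exact ⟨w ≫ f, key f⟩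
  · rintro c d g ⟨_, f, rfl⟩
    have e : (⟨ε.star f, w ≫ f, key f⟩ : hSet ε' c) = ⟨ε'.star (w ≫ f), w ≫ f, rfl⟩ :=
      Subtype.ext (key f).symm
    change (hMap ε g ⟨ε.star f, f, rfl⟩ : NormalCone C) = hMap ε' g ⟨ε.star f, w ≫ f, key f⟩
    rw [e, hMap_star, hMap_star]
    simp only [Category.assoc, key]

/-- The generator `ε = ε * 1°` lies in the larger functor, and writing it there as `ε' * w°` yields
`w`. -/
theorem exists_of_sub (k : Sub (ofCone ε h) (ofCone ε' h')) :
    ∃ w : ε'.vertex ⟶ ε.vertex, ∀ c, ε'.app c ≫ w = ε.app c := by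
  obtain ⟨w, hw⟩ := k.1 ε.vertex ⟨𝟙 _, ε.star_id⟩
  exact ⟨w, NormalCone.star_eq_iff.mp hw⟩

theorem incl_eq_homOf (k : Sub (ofCone ε h) (ofCone ε' h')) (w : ε'.vertex ⟶ ε.vertex)
    (hw : ∀ c, ε'.app c ≫ w = ε.app c) : incl k = homOf h h' w := by
  apply Hom.ext
  funext c ⟨_, f, hf⟩
  subst hf
  rw [homOf_star]
  exact Subtype.ext (NormalCone.star_eq_star_iff.mpr fun c => by rw [← hw, Category.assoc])

theorem ofCone_eq_of_iso (w : ε'.vertex ⟶ ε.vertex) (hw : ∀ c, ε'.app c ≫ w = ε.app c)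
    (v : ε.vertex ⟶ ε'.vertex) (hv : ∀ c, ε.app c ≫ v = ε'.app c) :
    ofCone ε h = ofCone ε' h' :=
  sub_antisymm (sub_ofCone w hw) (sub_ofCone v hv)

theorem homOf_injective {w v : ε'.vertex ⟶ ε.vertex} (e : homOf h h' w = homOf h h' v) :
    w = v := by
  have k := congrArg (fun η : ofCone ε h ⟶ ofCone ε' h' =>
    (Hom.app η ε.vertex ⟨ε.star (𝟙 _), 𝟙 _, rfl⟩ : NormalCone C)) e
  simp only [homOf_star, Category.comp_id] at k
  exact ε'.star_injective k

/-- Yoneda: naturality determines the transformation by its value on the generator `ε * 1°`. -/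
theorem exists_eq_homOf (η : ofCone ε h ⟶ ofCone ε' h') : ∃ w, η = homOf h h' w := by
  obtain ⟨w, hw⟩ := (Hom.app η ε.vertex ⟨ε.star (𝟙 _), 𝟙 _, rfl⟩).2
  refine ⟨w, Hom.ext ?_⟩
  funext c ⟨_, f, hf⟩
  subst hf
  rw [homOf_star]
  have n := Hom.naturality η f ⟨ε.star (𝟙 _), 𝟙 _, rfl⟩
  have e : (ofCone ε h).map f ⟨ε.star (𝟙 _), 𝟙 _, rfl⟩ = ⟨ε.star f, f, rfl⟩ :=
    (hMap_star ε f (𝟙 _)).trans (Subtype.ext (by rw [Category.id_comp]))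
  have e' : Hom.app η ε.vertex ⟨ε.star (𝟙 _), 𝟙 _, rfl⟩ = ⟨ε'.star w, w, rfl⟩ :=
    Subtype.ext hw.symm
  rw [e, e'] at n
  exact n.trans (hMap_star ε' f w)

/-- Two idempotents generating the same H-functor differ by an isomorphism of their vertices, so the
M-set can be read off any one of them. -/
theorem mem_mSet_ofCone {c : C} : c ∈ (ofCone ε h).mSet ↔ IsIso (ε.app c) := by
  constructor
  · rintro ⟨ε', h', e, hc⟩
    have e : ofCone ε h = ofCone ε' h' := ext_cf e
    have hc : IsIso (ε'.app c) := hc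
    obtain ⟨w, hw⟩ := exists_of_sub (show Sub (ofCone ε h) (ofCone ε' h') from e ▸ sub_refl _)
    obtain ⟨v, hv⟩ := exists_of_sub (show Sub (ofCone ε' h') (ofCone ε h) from e ▸ sub_refl _)
    obtain ⟨b, hb⟩ := ε.normal
    have hwv : w ≫ v = 𝟙 _ := by
      rw [← cancel_epi (ε'.app c), ← Category.assoc, hw, hv, Category.comp_id]
    have hvw : v ≫ w = 𝟙 _ := by
      rw [← cancel_epi (ε.app b), ← Category.assoc, hv, hw, Category.comp_id]
    have : IsIso w := ⟨v, hwv, hvw⟩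
    rw [← hw]
    infer_instance
  · intro hc
    exact ⟨ε, h, rfl, hc⟩

end Idem

/-- The idempotent cone `γ(c, d)`. -/
theorem exists_vertex_eq {F : NormalDual C} {c : C} (hc : c ∈ F.mSet) :
    ∃ (γ : NormalCone C) (h : IsIdempotentElem γ), γ.vertex = c ∧ F = ofCone γ h := by
  obtain ⟨ε, h, rfl⟩ := F.exists_eq_ofCone
  have hc := mem_mSet_ofCone.mp hc
  -- Composing with the inverse of `ε(c)` moves the vertex to `c` and makes the component there the
  -- identity, so the new cone is idempotent.
  let γ : NormalCone C :=
    { vertex := c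
      app := fun d => ε.app d ≫ inv (ε.app c)
      compat := fun k => by rw [← Category.assoc, ε.compat]
      normal := ⟨c, by infer_instance⟩ }
  have hγ : IsIdempotentElem γ := NormalCone.isIdempotentElem_iff.mpr (IsIso.hom_inv_id (ε.app c))
  refine ⟨γ, hγ, rfl, ofCone_eq_of_iso (ε.app c) (fun d => ?_) (inv (ε.app c)) fun d => rfl⟩
  change (ε.app d ≫ inv (ε.app c)) ≫ ε.app c = _
  simp

end NormalDual

/-- A fully faithful, inclusion preserving functor whose image contains the subobjects of each
object in its image is a local isomorphism. -/
theorem IsLocalIso.of_exists {C D : Type u} [SubobjectCategory C] [SubobjectCategory D] {F : C ⥤ D}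
    (map_incl : ∀ {c d : C} (h : Sub c d), ∃ k : Sub (F.obj c) (F.obj d), F.map (incl h) = incl k)
    (full : F.Full) (faithful : F.Faithful)
    (surj : ∀ (c : C) (b : D), Sub b (F.obj c) → ∃ a, Sub a c ∧ F.obj a = b) : IsLocalIso F := by
  refine ⟨map_incl, full, faithful, fun c => ⟨fun a ha => (map_incl ha).1, ?_, ?_⟩⟩
  -- The morphism `eqToHom` of an equality `F a = F b` lifts to `a ⟶ b` by fullness. By faithfulness
  -- the lift factors the inclusion of `a` through that of `b`, hence `a ≤ b`.
  · have key : ∀ {a b : C}, Sub a c → Sub b c → F.obj a = F.obj b → Sub a b := by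
      intro a b ha hb e
      obtain ⟨k, hk⟩ := map_incl ha
      obtain ⟨k', hk'⟩ := map_incl hb
      obtain ⟨s, _⟩ := incl_factor ha hb (F.preimage (eqToHom e)) (F.map_injective (by
        rw [F.map_comp, F.map_preimage, hk, hk', eqToHom_incl]))
      exact s
    intro a ha b hb e
    exact sub_antisymm (key ha hb e) (key hb ha e.symm)
  · intro b hb
    obtain ⟨a, ha, e⟩ := surj c b hb
    exact ⟨a, ha, e⟩

/-! ### The cones `ρ^a` in the powerset category -/

namespace Pow

variable {X : Type u}

theorem isIso_iff_bijective {A B : Pow X} (f : A ⟶ B) :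
    IsIso f ↔ Function.Bijective (f : A.carrier → B.carrier) := by
  constructor
  · intro _
    exact Function.bijective_iff_has_inverse.mpr
      ⟨inv f, fun x => congrFun (IsIso.hom_inv_id f) x, fun x => congrFun (IsIso.inv_hom_id f) x⟩
  · intro h
    obtain ⟨g, h₁, h₂⟩ := Function.bijective_iff_has_inverse.mp h
    exact ⟨g, funext h₁, funext h₂⟩

theorem rho_injective [Nontrivial X] : Function.Injective (rho (X := X)) := by
  have key : ∀ {γ δ : NormalCone (Pow X)}, γ = δ → ∀ (A : Pow X) (x : A.carrier),
      (γ.app A x : X) = δ.app A x := by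
    rintro γ _ rfl _ _
    rfl
  intro a b h
  refine Sing.ext (funext fun x => ?_)
  -- A second point makes `{x}` a proper subset, hence an object; the component of `ρ^a` there is
  -- the value of `a` at `x`.
  obtain ⟨y, hy⟩ := exists_ne x
  exact key h ⟨{x}, Set.singleton_nonempty x, fun k => hy (k ▸ Set.mem_univ y : y ∈ ({x} : Set X))⟩
    ⟨x, rfl⟩

theorem rho_star_eq {a b : Sing X} {A : Pow X} {f : (rho a).vertex ⟶ A}
    (h : ∀ x, (f ⟨a.toFun x, x, rfl⟩ : X) = b.toFun x) : (rho a).star f = rho b := by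
  refine NormalCone.star_eq_of_comp_incl (δ := rho b) ?_ fun B => ?_
  · rintro _ ⟨x, rfl⟩
    rw [← h]
    exact (f _).2
  · funext x
    exact Subtype.ext (h x).symm

theorem rho_mul (a b : Sing X) : rho a * rho b = rho (a * b) :=
  rho_star_eq (f := (rho b).app (rho a).vertex) fun _ => rfl

theorem rho_isIdempotentElem {a : Sing X} (h : IsIdempotentElem a) : IsIdempotentElem (rho a) :=
  NormalCone.mul_self_of_app _ (rho_app_vertex a h)

end Pow

/-! ### Transversals, and the functor from partitions to the normal dual -/

namespace Partn

variable {X : Type u}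

/-- The transformation `x ↦ h [x]`. -/
def toSing {p : Partn X} {A : Pow X} (h : Quotient p.rel → A.carrier) : Sing X where
  toFun x := h (Quotient.mk _ x)
  not_injective k := p.ne_bot (Setoid.ext fun x y =>
    ⟨fun e => k (congrArg (fun c => (h c : X)) (Quotient.sound e)), fun e => by
      rw [show x = y from e]⟩)
  not_surjective k := A.ne_univ (Set.eq_univ_of_forall fun y => by
    obtain ⟨x, rfl⟩ := k y
    exact (h _).2)

theorem rel_toSing {p : Partn X} {A : Pow X} (h : Quotient p.rel → A.carrier) :
    Sub (ker (toSing h)) p := fun _ _ e => congrArg (fun c => (h c : X)) (Quotient.sound e)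

/-- The map from the blocks of `π_a` to `X` induced by `a`. -/
def kerLift (a : Sing X) : Quotient (ker a).rel → X := Quotient.lift a.toFun fun _ _ h => h

theorem kerLift_injective (a : Sing X) : Function.Injective (kerLift a) := fun c d => by
  induction c using Quotient.inductionOn
  induction d using Quotient.inductionOn
  exact fun h => Quotient.sound h

theorem kerLift_mem (a : Sing X) (c : Quotient (ker a).rel) : kerLift a c ∈ (Pow.im a).carrier := by
  induction c using Quotient.inductionOn with
  | h x => exact ⟨x, rfl⟩

/-! ### Transversals -/

/-- `A` is a transversal of the partition `p`. -/
def IsTransversal (p : Partn X) (A : Pow X) : Prop :=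
  Function.Bijective fun x : A.carrier => Quotient.mk p.rel x.1

/-- The component at `A` is the map `x ↦ [x]` on `A` followed by the bijection from blocks to their
chosen representatives. -/
theorem mem_mSet_toDual {p : Partn X} {A : Pow X} :
    A ∈ ((toDual X).obj p).mSet ↔ IsTransversal p A := by
  refine (NormalDual.mem_mSet_ofCone (h := p.rho_idem)).trans ((Pow.isIso_iff_bijective _).trans ?_)
  have hb : Function.Bijective fun c : Quotient p.rel =>
      (⟨c.out, by obtain ⟨x, hx⟩ := c.exists_rep; exact ⟨x, congrArg Quotient.out hx⟩⟩ :
        (Pow.im p.idem).carrier) := by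
    constructor
    · intro c d h
      have h : c.out = d.out := congrArg Subtype.val h
      rw [← c.out_eq, ← d.out_eq, h]
    · rintro ⟨_, x, rfl⟩
      exact ⟨Quotient.mk _ x, rfl⟩
  exact hb.of_comp_iff' fun x : A.carrier => Quotient.mk p.rel x.1

/-- The map that takes a block of `p` to its element in the transversal `A`. -/
noncomputable def IsTransversal.rep {p : Partn X} {A : Pow X} (h : IsTransversal p A)
    (c : Quotient p.rel) : A.carrier := (h.2 c).choose

theorem IsTransversal.mk_rep {p : Partn X} {A : Pow X} (h : IsTransversal p A)
    (c : Quotient p.rel) : Quotient.mk p.rel (h.rep c).1 = c := (h.2 c).choose_spec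

theorem IsTransversal.rep_mk {p : Partn X} {A : Pow X} (h : IsTransversal p A)
    (x : A.carrier) : h.rep (Quotient.mk p.rel x.1) = x := h.1 (h.mk_rep _)

/-- Every element of `X` belongs to a transversal. -/
theorem exists_isTransversal (p : Partn X) (x : X) :
    ∃ A : Pow X, x ∈ A.carrier ∧ IsTransversal p A := by
  classical
  -- The standard representatives, changed in the block of `x` only, so as to pick `x`.
  let r : Quotient p.rel → X := fun c => if c = Quotient.mk _ x then x else c.out
  have hr : ∀ c, Quotient.mk p.rel (r c) = c := fun c => by
    by_cases h : c = Quotient.mk _ x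
    · simp only [r, h, if_true]
    · simp only [r, if_neg h, Quotient.out_eq]
  refine ⟨⟨Set.range r, ⟨_, Quotient.mk _ x, rfl⟩, fun h => p.ne_bot ?_⟩,
    ⟨Quotient.mk _ x, if_pos rfl⟩, ?_, fun c => ⟨⟨r c, c, rfl⟩, hr c⟩⟩
  · refine Setoid.ext fun y z => ⟨fun k => ?_, fun k => by rw [show y = z from k]⟩
    obtain ⟨c, rfl⟩ := (h ▸ Set.mem_univ y : y ∈ Set.range r)
    obtain ⟨d, rfl⟩ := (h ▸ Set.mem_univ z : z ∈ Set.range r)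
    have e := Quotient.sound k
    rw [hr, hr] at e
    rw [e]
  · rintro ⟨_, c, rfl⟩ ⟨_, d, rfl⟩ h
    have h : Quotient.mk p.rel (r c) = Quotient.mk p.rel (r d) := h
    rw [hr, hr] at h
    exact Subtype.ext (congrArg r h)

theorem IsTransversal.toSing_rep_mem {p : Partn X} {A : Pow X} (h : IsTransversal p A) {x : X}
    (hx : x ∈ A.carrier) : (toSing h.rep).toFun x = x := congrArg Subtype.val (h.rep_mk ⟨x, hx⟩)

theorem IsTransversal.isIdempotentElem_toSing {p : Partn X} {A : Pow X} (h : IsTransversal p A) :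
    IsIdempotentElem (toSing h.rep) := Sing.ext (funext fun _ => h.toSing_rep_mem (h.rep _).2)

theorem IsTransversal.ker_toSing {p : Partn X} {A : Pow X} (h : IsTransversal p A) :
    ker (toSing h.rep) = p := by
  refine sub_antisymm (rel_toSing _) fun x y k => Quotient.exact ?_
  rw [← h.mk_rep (Quotient.mk _ x), ← h.mk_rep (Quotient.mk _ y)]
  exact congrArg (Quotient.mk p.rel) k

theorem IsTransversal.im_toSing {p : Partn X} {A : Pow X} (h : IsTransversal p A) :
    Pow.im (toSing h.rep) = A := by
  refine Pow.ext (Set.Subset.antisymm ?_ fun x hx => ⟨x, h.toSing_rep_mem hx⟩)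
  rintro _ ⟨x, rfl⟩
  exact (h.rep _).2

/-! ### The functor from the partitions to the normal dual of `Pow X` -/

/-- The H-functors of the cones `ρ^e` only depend on the kernel of the idempotent `e`. -/
theorem toDual_obj_ker {e : Sing X} (he : IsIdempotentElem e) :
    (toDual X).obj (ker e) = NormalDual.ofCone (Pow.rho e) (Pow.rho_isIdempotentElem he) := by
  -- Idempotents with equal kernels absorb one another, so each of the two cones is the other
  -- followed by a map of vertices.
  have h₁ : ∀ x, e.toFun ((ker e).idem.toFun x) = e.toFun x := fun x =>
    Quotient.mk_out (s := (ker e).rel) x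
  have h₂ : ∀ x, (ker e).idem.toFun (e.toFun x) = (ker e).idem.toFun x := fun x =>
    congrArg Quotient.out (Quotient.sound (s := (ker e).rel) (congrFun (congrArg Sing.toFun he) x))
  refine NormalDual.ofCone_eq_of_iso (h := rho_idem _) (fun y => ⟨(ker e).idem.toFun y.1, _, rfl⟩) (fun A => ?_)
    (fun y => ⟨e.toFun y.1, _, rfl⟩) fun A => ?_
  · funext x
    exact Subtype.ext (h₂ x)
  · funext x
    exact Subtype.ext (h₁ x)

/-- The elements of `H(ρ^e; A)`, where `e` is an idempotent with `π_e = p`. -/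
noncomputable def dualEquiv (p : Partn X) (A : Pow X) :
    (Quotient p.rel → A.carrier) ≃ ((toDual X).obj p).obj A :=
  Equiv.trans (β := (Pow.rho p.idem).vertex ⟶ A)
    { toFun := fun h y => h (Quotient.mk p.rel y.1)
      invFun := fun f c => f ⟨c.out, by
        obtain ⟨x, hx⟩ := c.exists_rep
        exact ⟨x, congrArg Quotient.out hx⟩⟩
      left_inv := fun h => funext fun c => congrArg h c.out_eq
      right_inv := fun f => funext fun ⟨y, x, hx⟩ => by
        subst hx
        exact congrArg f (Subtype.ext (congrArg Quotient.out (Quotient.out_eq _))) }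
    (hEquiv _ A)

/-- The chosen idempotent has disappeared from the right side, so elements of different H-functors
can be compared as transformations. -/
theorem dualEquiv_val {p : Partn X} {A : Pow X} (h : Quotient p.rel → A.carrier) :
    (dualEquiv p A h).1 = Pow.rho (toSing h) :=
  Pow.rho_star_eq fun _ => congrArg (fun c => (h c).1) (Quotient.out_eq _)

/-- Together with `toDual_map_app`, this identifies the bifunctor `Γ(A, p)` with the functions from
blocks of `p` to `A`. -/
theorem toDual_obj_map {p : Partn X} {A B : Pow X} (f : A ⟶ B) (h : Quotient p.rel → A.carrier) :
    ((toDual X).obj p).map f (dualEquiv p A h) = dualEquiv p B fun c => f (h c) :=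
  hMap_star _ _ _

theorem toDual_map_app {p q : Partn X} (η : p ⟶ q) {A : Pow X} (h : Quotient p.rel → A.carrier) :
    NormalDual.Hom.app ((toDual X).map η) A (dualEquiv p A h) =
      dualEquiv q A fun c => h (η c) := by
  refine (NormalDual.homOf_star _ _ _ _).trans (congrArg (hEquiv (Pow.rho q.idem) A) ?_)
  funext y
  exact congrArg h (Quotient.out_eq _)

theorem between_injective {p q : Partn X} {η μ : p ⟶ q} (h : between η = between μ) : η = μ := by
  funext c
  have k := congrFun h ⟨c.out, by
    obtain ⟨x, hx⟩ := c.exists_rep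
    exact ⟨x, congrArg Quotient.out hx⟩⟩
  have k := congrArg (fun y => Quotient.mk p.rel y.1) k
  simpa [between] using k

theorem exists_eq_between {p q : Partn X} (w : (Pow.rho q.idem).vertex ⟶ (Pow.rho p.idem).vertex) :
    ∃ η : p ⟶ q, w = between η := by
  refine ⟨fun c => Quotient.mk p.rel (w ⟨c.out, by
    obtain ⟨x, hx⟩ := c.exists_rep
    exact ⟨x, congrArg Quotient.out hx⟩⟩).1, ?_⟩
  funext ⟨y, x, hx⟩
  subst hx
  have e : ∀ z : (Pow.im p.idem).carrier, (Quotient.mk p.rel z.1).out = z.1 := by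
    rintro ⟨_, z, rfl⟩
    exact congrArg Quotient.out (Quotient.out_eq _)
  refine Subtype.ext ((e (w _)).symm.trans (congrArg (fun z => (Quotient.mk p.rel (w z).1).out) ?_))
  exact Subtype.ext (congrArg Quotient.out (Quotient.out_eq _)).symm

variable (I : CatIdeal (Partn X))

theorem gamma_isLocalIso : IsLocalIso (gamma I) := by
  refine IsLocalIso.of_exists ?_ ⟨fun {p q} τ => ?_⟩ ⟨fun {p q} η μ h => ?_⟩ fun p F hF => ?_
  · intro p q h
    have hw : ∀ A, (Pow.rho q.1.idem).app A ≫ between (incl (C := Partn X) h) =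
        (Pow.rho p.1.idem).app A := fun A => funext fun x => Subtype.ext
      (congrArg (fun c => (incl (C := Partn X) h c).out) (Quotient.out_eq _))
    exact ⟨NormalDual.sub_ofCone _ hw, (NormalDual.incl_eq_homOf _ _ hw).symm⟩
  · obtain ⟨w, rfl⟩ := NormalDual.exists_eq_homOf (h := p.1.rho_idem) (h' := q.1.rho_idem) τ
    obtain ⟨η, rfl⟩ := exists_eq_between w
    exact ⟨η, rfl⟩
  · exact between_injective (NormalDual.homOf_injective h)
  -- The generator of a subfunctor is itself an element `ρ^a` of the larger H-functor. Here `a` is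
  -- idempotent and its kernel is coarser than `p`, so `π̄_a` lies in the ideal and maps to the
  -- subfunctor.
  · obtain ⟨ε, hε, rfl⟩ := F.exists_eq_ofCone
    obtain ⟨A, h, rfl⟩ : ∃ (A : Pow X) (h : Quotient p.1.rel → A.carrier),
        Pow.rho (toSing h) = ε := by
      obtain ⟨h, hh⟩ := (dualEquiv p.1 ε.vertex).surjective ⟨ε, hF.1 ε.vertex ⟨𝟙 _, ε.star_id⟩⟩
      exact ⟨_, h, (dualEquiv_val h).symm.trans (congrArg Subtype.val hh)⟩
    have he : IsIdempotentElem (toSing h) := by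
      refine Sing.ext (funext fun x => ?_)
      exact congrArg (fun y : (Pow.im (toSing h)).carrier => y.1)
        (congrFun (NormalCone.isIdempotentElem_iff.mp hε) ⟨(toSing h).toFun x, x, rfl⟩)
    exact ⟨⟨ker (toSing h), I.down (rel_toSing h) p.2⟩, rel_toSing h, toDual_obj_ker he⟩

end Partn

/-! ### The cones `σ^a` in the ideal, and retractions onto subsets -/

namespace Partn

variable {X : Type u} {I : CatIdeal (Partn X)}

theorem isIso_iff_bijective {p q : I.Obj} (f : p ⟶ q) :
    IsIso f ↔ Function.Bijective (f : Quotient q.1.rel → Quotient p.1.rel) := by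
  constructor
  · intro _
    exact Function.bijective_iff_has_inverse.mpr
      ⟨inv f, fun x => congrFun (IsIso.inv_hom_id f) x, fun x => congrFun (IsIso.hom_inv_id f) x⟩
  · intro h
    obtain ⟨g, h₁, h₂⟩ := Function.bijective_iff_has_inverse.mp h
    exact ⟨g, funext h₂, funext h₁⟩

theorem IsTotal.exists_isTransversal (hI : IsTotal I) (A : Pow X) :
    ∃ p : I.Obj, IsTransversal p.1 A := by
  obtain ⟨p, hp, h⟩ := hI A
  exact ⟨⟨p, hp⟩, mem_mSet_toDual.mp h⟩

theorem sigmaCone_app (a : Sing X) (h : ker a ∈ I.carrier) (p : I.Obj)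
    (c : Quotient (ker a).rel) : (sigmaCone I a h).app p c = Quotient.mk p.1.rel (kerLift a c) := by
  induction c using Quotient.inductionOn
  rfl

/-- The normal cone `σ^a`. -/
def sigmaNormal (hI : IsTotal I) (a : Sing X) (h : ker a ∈ I.carrier) : NormalCone I.Obj where
  toSubCone := sigmaCone I a h
  normal := by
    -- Totality gives a partition in `I` with transversal `Im a`. The component there is the
    -- composite of the bijections from blocks of `π_a` to `Im a` and from `Im a` to blocks of `p`.
    obtain ⟨p, hp⟩ := hI.exists_isTransversal (Pow.im a)
    refine ⟨p, (isIso_iff_bijective _).mpr ?_⟩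
    have e : ((sigmaCone I a h).app p : Quotient (ker a).rel → Quotient p.1.rel) =
        (fun x : (Pow.im a).carrier => Quotient.mk p.1.rel x.1) ∘
          fun c => ⟨kerLift a c, kerLift_mem a c⟩ := funext (sigmaCone_app a h p)
    rw [e]
    refine hp.comp ⟨fun c d k => kerLift_injective a (congrArg Subtype.val k), ?_⟩
    rintro ⟨_, x, rfl⟩
    exact ⟨Quotient.mk _ x, rfl⟩

theorem star_eq_sigmaNormal (hI : IsTotal I) {γ : NormalCone I.Obj} {p : I.Obj}
    {g : γ.vertex ⟶ p} {a : Sing X} (h : ker a ∈ I.carrier) (k : Sub (ker a) p.1)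
    (e : ∀ (q : I.Obj) (x : X),
      γ.app q (g (Quotient.mk p.1.rel x)) = Quotient.mk q.1.rel (a.toFun x)) :
    γ.star g = sigmaNormal hI a h := by
  refine NormalCone.star_eq_of_comp_incl (δ := sigmaNormal hI a h) k fun q => ?_
  funext c
  induction c using Quotient.inductionOn with
  | h x => exact (e q x).symm

/-- Morphisms of `I` are maps of blocks taken backwards, so `a ↦ σ^a` reverses products. This is
what the opposite in the second factor of the linked pairs absorbs. -/
theorem sigmaNormal_mul (hI : IsTotal I) {a b : Sing X} (ha : ker a ∈ I.carrier)
    (hb : ker b ∈ I.carrier) (hab : ker (a * b) ∈ I.carrier) :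
    sigmaNormal hI b hb * sigmaNormal hI a ha = sigmaNormal hI (a * b) hab :=
  star_eq_sigmaNormal hI (p := ⟨ker a, ha⟩) hab (fun _ _ k => congrArg b.toFun k) fun _ _ => rfl

variable (I) in
/-- An idempotent `e` with `Im e = A` and `π̄_e` in `I`. -/
structure Retraction (A : Pow X) where
  map : Sing X
  ker_mem : ker map ∈ I.carrier
  map_mem : ∀ x, map.toFun x ∈ A.carrier
  map_eq : ∀ x ∈ A.carrier, map.toFun x = x

theorem IsTotal.nonempty_retraction (hI : IsTotal I) (A : Pow X) : Nonempty (Retraction I A) := by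
  obtain ⟨p, hp⟩ := hI.exists_isTransversal A
  exact ⟨toSing hp.rep, hp.ker_toSing.symm ▸ p.2, fun _ => (hp.rep _).2,
    fun _ => hp.toSing_rep_mem⟩

/-- An idempotent is a retraction onto its image. -/
def Retraction.ofIdem (e : Sing X) (h : ker e ∈ I.carrier) (he : IsIdempotentElem e) :
    Retraction I (Pow.im e) where
  map := e
  ker_mem := h
  map_mem x := ⟨x, rfl⟩
  map_eq := by
    rintro _ ⟨x, rfl⟩
    exact congrFun (congrArg Sing.toFun he) x

namespace Retraction

variable {A B : Pow X} (R : Retraction I A) (R' : Retraction I B)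

theorem isIdempotentElem : IsIdempotentElem R.map :=
  Sing.ext (funext fun x => R.map_eq _ (R.map_mem x))

/-- The cone `σ^e`. -/
def cone : NormalCone I.Obj := sigma I R.map R.ker_mem R.isIdempotentElem

theorem cone_idem : IsIdempotentElem R.cone := sigma_idem I R.map R.ker_mem R.isIdempotentElem

/-- The bijection from the blocks of `π_e` to `Im e`. -/
def lift : Quotient (ker R.map).rel ≃ A.carrier where
  toFun c := ⟨kerLift R.map c, by
    induction c using Quotient.inductionOn with
    | h x => exact R.map_mem x⟩
  invFun x := Quotient.mk _ x.1
  left_inv c := by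
    induction c using Quotient.inductionOn with
    | h x => exact Quotient.sound (R.map_eq _ (R.map_mem x))
  right_inv x := Subtype.ext (R.map_eq _ x.2)

theorem cone_app (p : I.Obj) (c : Quotient (ker R.map).rel) :
    R.cone.app p c = Quotient.mk p.1.rel (R.lift c).1 := sigmaCone_app R.map R.ker_mem p c

/-- The morphism from `π̄_{e'}` to `π̄_e` determined by a map from `Im e` to `Im e'`. -/
def hom (f : A ⟶ B) : R'.cone.vertex ⟶ R.cone.vertex := fun c => R'.lift.symm (f (R.lift c))

theorem isIso_cone_app (p : I.Obj) : IsIso (R.cone.app p) ↔ IsTransversal p.1 A := by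
  have e : (R.cone.app p : Quotient (ker R.map).rel → Quotient p.1.rel) =
      (fun x : A.carrier => Quotient.mk p.1.rel x.1) ∘ R.lift := funext (R.cone_app p)
  rw [isIso_iff_bijective, e]
  exact R.lift.bijective.of_comp_iff _

/-- After identifying blocks of `π_e` with points of `A`, the components of `σ^e` are `x ↦ [x]` and
involve `A` alone. Hence `Δ(A)` does not depend on the idempotent. -/
theorem ofCone_eq (S : Retraction I A) :
    NormalDual.ofCone R.cone R.cone_idem = NormalDual.ofCone S.cone S.cone_idem := by
  have key : ∀ (R S : Retraction I A) (p : I.Obj), R.cone.app p ≫ S.hom R (𝟙 A) = S.cone.app p := by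
    intro R S p
    funext c
    refine (R.cone_app p _).trans (Eq.trans ?_ (S.cone_app p c).symm)
    exact congrArg (fun x => Quotient.mk p.1.rel x.1) (R.lift.apply_symm_apply _)
  exact NormalDual.ofCone_eq_of_iso _ (key S R) _ (key R S)

/-- The elements of `H(σ^e; p)`. -/
noncomputable def coneEquiv (p : I.Obj) :
    (Quotient p.1.rel → A.carrier) ≃ (NormalDual.ofCone R.cone R.cone_idem).obj p :=
  Equiv.trans (β := R.cone.vertex ⟶ p)
    { toFun := fun h c => R.lift.symm (h c)
      invFun := fun g c => R.lift (g c)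
      left_inv := fun _ => funext fun _ => R.lift.apply_symm_apply _
      right_inv := fun _ => funext fun _ => R.lift.symm_apply_apply _ }
    (hEquiv _ p)

/-- The counterpart of `dualEquiv_val`: the same function `h` gives the same transformation on both
sides, and the retraction disappears. -/
theorem coneEquiv_val (hI : IsTotal I) {p : I.Obj} (h : Quotient p.1.rel → A.carrier) :
    (R.coneEquiv p h).1 = sigmaNormal hI (toSing h) (I.down (rel_toSing h) p.2) := by
  refine star_eq_sigmaNormal hI _ (rel_toSing h) fun q x => ?_
  refine (R.cone_app q _).trans ?_
  exact congrArg (fun x => Quotient.mk q.1.rel x.1) (R.lift.apply_symm_apply _)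

theorem ofCone_map {p q : I.Obj} (g : p ⟶ q) (h : Quotient p.1.rel → A.carrier) :
    (NormalDual.ofCone R.cone R.cone_idem).map g (R.coneEquiv p h) =
      R.coneEquiv q fun c => h (g c) :=
  hMap_star _ _ _

theorem homOf_hom_app (f : A ⟶ B) {p : I.Obj} (h : Quotient p.1.rel → A.carrier) :
    NormalDual.Hom.app (NormalDual.homOf R.cone_idem R'.cone_idem (R.hom R' f)) p
      (R.coneEquiv p h) = R'.coneEquiv p fun c => f (h c) := by
  refine (NormalDual.homOf_star _ _ _ _).trans (congrArg (hEquiv R'.cone p) ?_)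
  funext c
  exact congrArg (fun x => R'.lift.symm (f x)) (R.lift.apply_symm_apply _)

theorem hom_injective {f g : A ⟶ B} (h : R.hom R' f = R.hom R' g) : f = g := by
  funext x
  have k := R'.lift.symm.injective (congrFun h (R.lift.symm x))
  simpa using k

theorem exists_eq_hom (w : R'.cone.vertex ⟶ R.cone.vertex) : ∃ f : A ⟶ B, w = R.hom R' f := by
  refine ⟨fun x => R'.lift (w (R.lift.symm x)), funext fun c => ?_⟩
  refine (R'.lift.symm_apply_apply _).symm.trans ?_
  exact congrArg (fun c => R'.lift.symm (R'.lift (w c))) (R.lift.symm_apply_apply c).symm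

end Retraction

/-! ### The dual functor and its description as the identity -/

section Dual

variable (r : ∀ A : Pow X, Retraction I A)

/-- The functor `A ↦ H(σ^e; -)`, where `e` is a chosen idempotent with image `A`. -/
noncomputable def dual : Pow X ⥤ NormalDual I.Obj where
  obj A := NormalDual.ofCone (r A).cone (r A).cone_idem
  map {A B} f := NormalDual.homOf (r A).cone_idem (r B).cone_idem ((r A).hom (r B) f)
  map_id A := by
    rw [← NormalDual.homOf_id]
    exact congrArg _ (funext fun c => (r A).lift.symm_apply_apply c)
  map_comp {A B D} f g := by
    rw [← NormalDual.homOf_comp]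
    refine congrArg _ (funext fun c => ?_)
    exact congrArg (fun x => (r D).lift.symm (g x)) ((r B).lift.apply_symm_apply _).symm

theorem mem_mSet_dual {A : Pow X} {p : I.Obj} : p ∈ ((dual r).obj A).mSet ↔ IsTransversal p.1 A :=
  (NormalDual.mem_mSet_ofCone (h := (r A).cone_idem)).trans ((r A).isIso_cone_app p)

theorem dual_isLocalIso (hI : IsTotal I) : IsLocalIso (dual r) := by
  refine IsLocalIso.of_exists ?_ ⟨fun {A B} τ => ?_⟩ ⟨fun {A B} f g h => ?_⟩ fun A F hF => ?_
  · intro A B h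
    have hw : ∀ p, (r B).cone.app p ≫ (r A).hom (r B) (incl h) = (r A).cone.app p := by
      intro p
      funext c
      refine ((r B).cone_app p _).trans (Eq.trans ?_ ((r A).cone_app p c).symm)
      exact congrArg (fun x => Quotient.mk p.1.rel x.1) ((r B).lift.apply_symm_apply _)
    exact ⟨NormalDual.sub_ofCone _ hw, (NormalDual.incl_eq_homOf _ _ hw).symm⟩
  · obtain ⟨w, rfl⟩ :=
      NormalDual.exists_eq_homOf (h := (r A).cone_idem) (h' := (r B).cone_idem) τ
    obtain ⟨f, rfl⟩ := (r A).exists_eq_hom (r B) w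
    exact ⟨f, rfl⟩
  · exact (r A).hom_injective (r B) (NormalDual.homOf_injective h)
  -- The generator of a subfunctor is some `σ^a` with `a` idempotent and `Im a ⊆ A`, so the
  -- subfunctor comes from the object `Im a`.
  · obtain ⟨ε, hε, rfl⟩ := F.exists_eq_ofCone
    obtain ⟨p, h, rfl⟩ : ∃ (p : I.Obj) (h : Quotient p.1.rel → A.carrier),
        sigmaNormal hI (toSing h) (I.down (rel_toSing h) p.2) = ε := by
      obtain ⟨h, hh⟩ := ((r A).coneEquiv ε.vertex).surjective
        ⟨ε, hF.1 ε.vertex ⟨𝟙 _, ε.star_id⟩⟩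
      exact ⟨_, h, ((r A).coneEquiv_val hI h).symm.trans (congrArg Subtype.val hh)⟩
    have he : IsIdempotentElem (toSing h) := by
      refine Sing.ext (funext fun x => ?_)
      exact Quotient.exact (congrFun (NormalCone.isIdempotentElem_iff.mp hε)
        (Quotient.mk (ker (toSing h)).rel x))
    refine ⟨Pow.im (toSing h), ?_, ?_⟩
    · rintro _ ⟨x, rfl⟩
      exact (h _).2
    · exact (r _).ofCone_eq (Retraction.ofIdem (toSing h) (I.down (rel_toSing h) p.2) he)

theorem dual_isIdentity (hI : IsTotal I) : IsIdentity I (dual r) := by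
  refine ⟨fun e h he => (r _).ofCone_eq (Retraction.ofIdem e h he), ?_⟩
  intro e e' h he h' he' f p g hg
  let R := Retraction.ofIdem e h he
  let R' := Retraction.ofIdem e' h' he'
  obtain ⟨j, hj⟩ := (R.coneEquiv p).surjective ⟨(sigma I e h he).star g, g, rfl⟩
  have hhat : R.hom R' f = hat I h he h' he' f := by
    funext c
    induction c using Quotient.inductionOn
    rfl
  -- The function `j` gives the same cone for the chosen retraction and for `e`, so the computation
  -- passes from one to the other and back.
  have hr : (r _).coneEquiv p j = ⟨_, hg⟩ := Subtype.ext
    (((r _).coneEquiv_val hI j).trans ((R.coneEquiv_val hI j).symm.trans (congrArg Subtype.val hj)))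
  have e₁ := (r _).homOf_hom_app (r _) f j
  have e₂ := R.homOf_hom_app R' f j
  rw [hj] at e₂
  have e₃ := NormalDual.homOf_star R.cone_idem R'.cone_idem (R.hom R' f) g
  rw [← hhat]
  calc _ = _ := congrArg (fun x => (NormalDual.Hom.app ((dual r).map f) p x).1) hr.symm
    _ = _ := congrArg Subtype.val e₁
    _ = _ := (r _).coneEquiv_val hI _
    _ = _ := (R'.coneEquiv_val hI _).symm
    _ = _ := congrArg Subtype.val (e₂.symm.trans e₃)

/-! ### The duality `ρ^a ↦ σ^a` -/

section Duality

theorem gamma_isCrossConnection (hI : IsTotal I) : IsCrossConnection (gamma I) :=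
  ⟨gamma_isLocalIso I, fun A => by
    obtain ⟨p, hp⟩ := hI.exists_isTransversal A
    exact ⟨p, mem_mSet_toDual.mpr hp⟩⟩

theorem dual_isCrossConnection (hI : IsTotal I) : IsCrossConnection (dual r) :=
  ⟨dual_isLocalIso r hI, fun p => by
    obtain ⟨x⟩ := p.1.nonempty
    obtain ⟨A, _, hA⟩ := p.1.exists_isTransversal x
    exact ⟨A, (mem_mSet_dual r).mpr hA⟩⟩

/-- The bijection `ρ^a ↦ σ^a`. -/
noncomputable def chi (A : Pow X) (p : I.Obj) :
    ((gamma I).obj p).obj A ≃ ((dual r).obj A).obj p :=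
  (dualEquiv p.1 A).symm.trans ((r A).coneEquiv p)

theorem chi_dualEquiv {A : Pow X} {p : I.Obj} (h : Quotient p.1.rel → A.carrier) :
    chi r A p (dualEquiv p.1 A h) = (r A).coneEquiv p h :=
  congrArg ((r A).coneEquiv p) ((dualEquiv p.1 A).symm_apply_apply h)

theorem leftMap_gamma {A B : Pow X} {p q : I.Obj} (f : A ⟶ B) (g : p ⟶ q)
    (h : Quotient p.1.rel → A.carrier) :
    leftMap (gamma I) f g (dualEquiv p.1 A h) = dualEquiv q.1 B fun c => f (h (g c)) :=
  (congrArg (NormalDual.Hom.app ((toDual X).map g) B) (toDual_obj_map f h)).trans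
    (toDual_map_app _ _)

theorem rightMap_dual {A B : Pow X} {p q : I.Obj} (f : A ⟶ B) (g : p ⟶ q)
    (h : Quotient p.1.rel → A.carrier) :
    rightMap (dual r) f g ((r A).coneEquiv p h) = (r B).coneEquiv q fun c => f (h (g c)) :=
  (congrArg (NormalDual.Hom.app ((dual r).map f) q) ((r A).ofCone_map g h)).trans
    ((r A).homOf_hom_app _ _ _)

/-- The duality that takes `ρ^a` to `σ^a`. -/
noncomputable def duality (hI : IsTotal I) : Duality (gamma I) (dual r) where
  isCross := gamma_isCrossConnection hI
  isCross_dual := dual_isCrossConnection r hI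
  mem_iff _ _ := mem_mSet_toDual.trans (mem_mSet_dual r).symm
  χ := chi r
  naturality {A B p q} f g x := by
    obtain ⟨h, rfl⟩ := (dualEquiv p.1 A).surjective x
    have e₁ := (congrArg (chi r B q) (leftMap_gamma f g h)).trans (chi_dualEquiv r _)
    have e₂ := (congrArg (rightMap (dual r) f g) (chi_dualEquiv r h)).trans (rightMap_dual r f g h)
    exact e₁.trans e₂.symm
  unit A p x y hx hxA _ hy hyp _ := by
    obtain ⟨h, rfl⟩ := (dualEquiv p.1 A).surjective x
    obtain ⟨k, rfl⟩ := ((r A).coneEquiv p).surjective y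
    refine (chi_dualEquiv r h).trans (congrArg ((r A).coneEquiv p) ?_)
    rw [dualEquiv_val] at hx hxA
    rw [(r A).coneEquiv_val hI] at hy hyp
    -- Idempotence of `x` with vertex `A` makes `h` fix the points of `A`; idempotence of `y` with
    -- vertex `p` makes `k` choose a point in each block. Hence `h c = h [k c] = k c`.
    have hh : ∀ a : A.carrier, h (Quotient.mk _ a.1) = a := by
      rintro ⟨a, ha⟩
      obtain ⟨x, rfl⟩ : a ∈ (Pow.im (toSing h)).carrier :=
        (Set.ext_iff.mp (congrArg Pow.carrier hxA) a).mpr ha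
      exact Subtype.ext (congrArg (fun y : (Pow.im (toSing h)).carrier => y.1)
        (congrFun (NormalCone.isIdempotentElem_iff.mp hx) ⟨(toSing h).toFun x, x, rfl⟩))
    have hk : ∀ c, Quotient.mk p.1.rel (k c).1 = c := by
      have hv : ker (toSing k) = p.1 := congrArg Subtype.val hyp
      intro c
      induction c using Quotient.inductionOn with
      | h x =>
        have e : Quotient.mk (ker (toSing k)).rel (k (Quotient.mk _ x)).1 = Quotient.mk _ x :=
          congrFun (NormalCone.isIdempotentElem_iff.mp hy) (Quotient.mk (ker (toSing k)).rel x)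
        have e' : (ker (toSing k)).rel (k (Quotient.mk _ x)).1 x := Quotient.exact e
        rw [hv] at e'
        exact Quotient.sound e'
    funext c
    calc h c = h (Quotient.mk _ (k c).1) := by rw [hk]
      _ = k c := hh _

end Duality

end Dual

end Partn

/-- Values of both functors are sets of cones, so the morphisms can be compared on underlying cones,
with no transport along the equalities of objects. -/
theorem NormalDual.functor_ext {B C : Type u} [Category.{u} B] [SubobjectCategory C]
    [IsNormalCategory C] {F G : B ⥤ NormalDual C} (hobj : ∀ b, F.obj b = G.obj b)
    (hmap : ∀ {b b' : B} (f : b ⟶ b') (c : C) (x : (F.obj b).obj c) (y : (G.obj b).obj c),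
      x.1 = y.1 → (Hom.app (F.map f) c x).1 = (Hom.app (G.map f) c y).1) : F = G := by
  have key : ∀ {P P' Q Q' : NormalDual C} (η : P ⟶ Q) (η' : P' ⟶ Q'), P = P' → Q = Q' →
      (∀ (c : C) (x : P.obj c) (y : P'.obj c), x.1 = y.1 →
        (Hom.app η c x).1 = (Hom.app η' c y).1) → HEq η η' := by
    rintro P _ Q _ η η' rfl rfl h
    exact heq_of_eq (Hom.ext (funext fun c => funext fun x => Subtype.ext (h c x x rfl)))
  exact CategoryTheory.Functor.hext hobj fun b b' f => key _ _ (hobj b) (hobj b') (hmap f)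

/-! ### Uniqueness of the dual, and the linked pairs -/

namespace Partn

variable {X : Type u} {I : CatIdeal (Partn X)}

section Duality

variable {Δ : Pow X ⥤ NormalDual I.Obj} (D : Duality (gamma I) Δ)

/-- The cone `y` is the idempotent cone `δ(A, p)`, where `p` is the vertex of `y`. -/
structure IsUnitCone (A : Pow X) (y : NormalCone I.Obj) : Prop where
  idem : IsIdempotentElem y
  transversal : IsTransversal y.vertex.1 A
  obj : Δ.obj A = NormalDual.ofCone y idem
  χ_eq : (D.χ A y.vertex (dualEquiv y.vertex.1 A transversal.rep)).1 = y

/-- The projection onto `A` along the blocks of `p` is an idempotent with image `A` and kernel `p`.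
Its `ρ` is therefore the cone `γ(A, p)` to which the axiom `unit` applies. -/
theorem exists_isUnitCone {A : Pow X} {p : I.Obj} (h : IsTransversal p.1 A) :
    ∃ y, y.vertex = p ∧ IsUnitCone D A y := by
  obtain ⟨y, hy, rfl, e⟩ :=
    NormalDual.exists_vertex_eq ((D.mem_iff A p).mp (mem_mSet_toDual.mpr h))
  refine ⟨y, rfl, hy, h, e, ?_⟩
  have hm : y ∈ (Δ.obj A).obj y.vertex := by
    rw [e]
    exact ⟨𝟙 _, y.star_id⟩
  have hρ := Pow.rho_isIdempotentElem h.isIdempotentElem_toSing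
  refine congrArg Subtype.val (D.unit A y.vertex (dualEquiv y.vertex.1 A h.rep) ⟨y, hm⟩ ?_ ?_ ?_
    hy rfl (congrArg NormalDual.toConeFunctor e))
  · rw [dualEquiv_val]
    exact hρ
  · rw [dualEquiv_val]
    exact h.im_toSing
  · rw [dualEquiv_val]
    have k := toDual_obj_ker h.isIdempotentElem_toSing
    rw [h.ker_toSing] at k
    exact congrArg NormalDual.toConeFunctor k

theorem map_app_χ {A B : Pow X} (f : A ⟶ B) {p : I.Obj} (j : Quotient p.1.rel → A.carrier) :
    NormalDual.Hom.app (Δ.map f) p (D.χ A p (dualEquiv p.1 A j)) =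
      D.χ B p (dualEquiv p.1 B fun c => f (j c)) := by
  have h := D.naturality f (𝟙 p) (dualEquiv p.1 A j)
  rw [leftMap_gamma, rightMap, (Δ.obj A).map_id] at h
  exact h.symm

/-- `Δ` preserves inclusions, and an inclusion of H-functors leaves each cone unchanged. -/
theorem χ_incl {A B : Pow X} (h : Sub A B) {p : I.Obj} (j : Quotient p.1.rel → A.carrier) :
    (D.χ A p (dualEquiv p.1 A j)).1 = (D.χ B p (dualEquiv p.1 B fun c => ⟨j c, h (j c).2⟩)).1 := by
  obtain ⟨k, hk⟩ := D.isCross_dual.localIso.map_incl h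
  have e := map_app_χ D (incl h) j
  rw [hk] at e
  exact congrArg Subtype.val e

theorem obj_map_val {F : NormalDual I.Obj} {y : NormalCone I.Obj} {hy : IsIdempotentElem y}
    (e : F = NormalDual.ofCone y hy) {p : I.Obj} (g : y.vertex ⟶ p) (x : F.obj y.vertex)
    (hx : x.1 = y) : (F.map g x).1 = y.star g := by
  subst e
  have hx : x = ⟨y.star (𝟙 _), 𝟙 _, rfl⟩ := Subtype.ext (hx.trans y.star_id.symm)
  rw [hx]
  refine (congrArg Subtype.val (hMap_star y g (𝟙 _))).trans ?_
  simp

/-- Every `j` factors as `c ↦ [j c]` followed by the transversal's choice of representatives.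
Naturality in the partition then expresses all of `χ` over `A` through the unit cone. -/
theorem IsUnitCone.χ_val {A : Pow X} {y : NormalCone I.Obj} (hy : IsUnitCone D A y) {p : I.Obj}
    (j : Quotient p.1.rel → A.carrier) : (D.χ A p (dualEquiv p.1 A j)).1 =
      y.star (d := p) fun c => Quotient.mk y.vertex.1.rel (j c).1 := by
  let g : y.vertex ⟶ p := fun c => Quotient.mk y.vertex.1.rel (j c).1
  have h := D.naturality (𝟙 A) g (dualEquiv y.vertex.1 A hy.transversal.rep)
  have e : leftMap (gamma I) (𝟙 A) g (dualEquiv y.vertex.1 A hy.transversal.rep) =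
      dualEquiv p.1 A j :=
    (leftMap_gamma _ _ _).trans (congrArg _ (funext fun c => hy.transversal.rep_mk (j c)))
  rw [e, rightMap, Δ.map_id] at h
  rw [h]
  exact obj_map_val hy.obj g _ hy.χ_eq

/-- The heart of uniqueness. The constant function `x` has values in `{x}`, which lies both in `A`
and in a transversal `B` of `q` through `x`, so by `χ_incl` the unit cones `y` of `A` and `z = δ(B,
q)` give it the same image. At `q` this equates their values on the block of `x`, and `z` is the
identity at its own vertex `q`. -/
theorem IsUnitCone.app_mk [Nontrivial X] {A : Pow X} {y : NormalCone I.Obj}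
    (hy : IsUnitCone D A y) {x : X} (hx : x ∈ A.carrier) (q : I.Obj) :
    y.app q (Quotient.mk y.vertex.1.rel x) = Quotient.mk q.1.rel x := by
  obtain ⟨B, hxB, hB⟩ := q.1.exists_isTransversal x
  obtain ⟨z, rfl, hz⟩ := exists_isUnitCone D hB
  let P : Pow X := ⟨{x}, Set.singleton_nonempty x, fun k => by
    obtain ⟨w, hw⟩ := exists_ne x
    exact hw (k ▸ Set.mem_univ w : w ∈ ({x} : Set X))⟩
  have hA : Sub P A := Set.singleton_subset_iff.mpr hx
  have hB : Sub P B := Set.singleton_subset_iff.mpr hxB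
  let j : Quotient z.vertex.1.rel → P.carrier := fun _ => ⟨x, rfl⟩
  have e := (χ_incl D hA j).symm.trans (χ_incl D hB j)
  rw [hy.χ_val, hz.χ_val] at e
  have e₁ := congrFun (NormalCone.star_eq_star_iff.mp e z.vertex) (Quotient.mk _ x)
  exact e₁.trans (congrFun (NormalCone.isIdempotentElem_iff.mp hz.idem) (Quotient.mk _ x))

theorem χ_dualEquiv_val [Nontrivial X] (hI : IsTotal I) {A : Pow X} {p : I.Obj}
    (j : Quotient p.1.rel → A.carrier) : (D.χ A p (dualEquiv p.1 A j)).1 =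
      sigmaNormal hI (toSing j) (I.down (rel_toSing j) p.2) := by
  obtain ⟨q, hq⟩ := hI.exists_isTransversal A
  obtain ⟨y, -, hy⟩ := exists_isUnitCone D hq
  rw [hy.χ_val]
  exact star_eq_sigmaNormal hI _ (rel_toSing j) fun q x => hy.app_mk D (j _).2 q

theorem obj_eq_ofCone [Nontrivial X] (D : Duality (gamma I) Δ) (hI : IsTotal I) {A : Pow X} (R : Retraction I A) :
    Δ.obj A = NormalDual.ofCone R.cone R.cone_idem := by
  obtain ⟨q, hq⟩ := hI.exists_isTransversal A
  obtain ⟨y, -, hy⟩ := exists_isUnitCone D hq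
  rw [hy.obj]
  refine NormalDual.ofCone_eq_of_iso (fun c => R.lift.symm (hy.transversal.rep c)) (fun p => ?_)
    (fun c => Quotient.mk _ (R.lift c).1) fun p => ?_
  · funext c
    calc _ = Quotient.mk p.1.rel (R.lift (R.lift.symm (hy.transversal.rep c))).1 := R.cone_app p _
      _ = Quotient.mk p.1.rel (hy.transversal.rep c).1 := by rw [R.lift.apply_symm_apply]
      _ = y.app p (Quotient.mk _ (hy.transversal.rep c).1) :=
        (hy.app_mk D (hy.transversal.rep c).2 p).symm
      _ = y.app p c := congrArg (y.app p) (hy.transversal.mk_rep c)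
  · funext c
    exact (hy.app_mk D (R.lift c).2 p).trans (R.cone_app p c).symm

/-- The dual cross-connection is unique. -/
theorem eq_dual [Nontrivial X] (D : Duality (gamma I) Δ) (hI : IsTotal I)
    (r : ∀ A : Pow X, Retraction I A) : Δ = dual r := by
  refine NormalDual.functor_ext (fun A => obj_eq_ofCone D hI (r A)) ?_
  intro A B f p x y hxy
  -- Every element of `Δ(A)(p)` is a value of `χ`, so naturality of `χ` prescribes the action of
  -- `Δ(f)`.
  obtain ⟨u, rfl⟩ := (D.χ A p).surjective x
  obtain ⟨j, rfl⟩ := (dualEquiv p.1 A).surjective u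
  have hy : y = (r A).coneEquiv p j := Subtype.ext
    (hxy.symm.trans ((χ_dualEquiv_val D hI j).trans ((r A).coneEquiv_val hI j).symm))
  subst hy
  calc _ = _ := congrArg Subtype.val (map_app_χ D f j)
    _ = _ := χ_dualEquiv_val D hI _
    _ = _ := ((r B).coneEquiv_val hI _).symm
    _ = _ := congrArg Subtype.val ((r A).homOf_hom_app (r B) f j).symm

/-- The homomorphism `a ↦ (ρ^a, σ^a)`. -/
def toPair (hI : IsTotal I) :
    singSub I →ₙ* NormalCone (Pow X) × (NormalCone I.Obj)ᵐᵒᵖ where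
  toFun a := (Pow.rho a.1, MulOpposite.op (sigmaNormal hI a.1 a.2))
  map_mul' a b := Prod.ext (Pow.rho_mul a.1 b.1).symm
    (congrArg MulOpposite.op (sigmaNormal_mul hI a.2 b.2 (a * b).2).symm)

theorem toPair_injective [Nontrivial X] (hI : IsTotal I) : Function.Injective (toPair hI) :=
  fun _ _ h => Subtype.ext (Pow.rho_injective (congrArg Prod.fst h))

theorem range_toPair [Nontrivial X] (hI : IsTotal I) :
    Set.range (toPair hI) = linkedPairs D := by
  ext ⟨γ, δ⟩
  constructor
  · rintro ⟨a, h⟩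
    obtain ⟨rfl, rfl⟩ := Prod.mk.inj h
    -- Each `a` is `toSing` of the map it induces from its own blocks to its own image, so its pair
    -- is linked at `(Im a, π̄_a)`.
    let j : Quotient (ker a.1).rel → (Pow.im a.1).carrier :=
      fun c => ⟨kerLift a.1 c, kerLift_mem a.1 c⟩
    have hj : Pow.rho a.1 = (dualEquiv _ _ j).1 := (dualEquiv_val j).symm
    refine ⟨Pow.im a.1, ⟨ker a.1, a.2⟩, hj ▸ (dualEquiv _ _ j).2, ?_⟩
    refine (χ_dualEquiv_val D hI (p := ⟨ker a.1, a.2⟩) j).symm.trans ?_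
    exact congrArg (fun x => (D.χ _ ⟨ker a.1, a.2⟩ x).1) (Subtype.ext hj.symm)
  · rintro ⟨A, p, h, e⟩
    obtain ⟨j, hj⟩ := (dualEquiv p.1 A).surjective ⟨γ, h⟩
    refine ⟨⟨toSing j, I.down (rel_toSing j) p.2⟩, Prod.ext ?_ (MulOpposite.unop_injective ?_)⟩
    · exact (dualEquiv_val j).symm.trans (congrArg Subtype.val hj)
    · refine (χ_dualEquiv_val D hI j).symm.trans (Eq.trans ?_ e.symm)
      exact congrArg (fun x => (D.χ A p x).1) hj

theorem exists_mulEquiv_linkedPairs [Nontrivial X] (hI : IsTotal I) :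
    ∃ S : Subsemigroup (NormalCone (Pow X) × (NormalCone I.Obj)ᵐᵒᵖ),
      (S : Set (NormalCone (Pow X) × (NormalCone I.Obj)ᵐᵒᵖ)) = linkedPairs D ∧
      ∃ φ : singSub I ≃* S, ∀ a : singSub I, (φ a).1.1 = Pow.rho a.1 ∧
        (φ a).1.2.unop.toSubCone = sigmaCone I a.1 a.2 :=
  -- Closure of the linked pairs under the product comes for free, since they are the range of a
  -- homomorphism.
  ⟨(toPair hI).srange, (MulHom.coe_srange _).trans (range_toPair D hI),
    MulEquiv.ofBijective (toPair hI).srangeRestrict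
      ⟨fun _ _ h => toPair_injective hI (congrArg Subtype.val h),
        (toPair hI).srangeRestrict_surjective⟩,
    fun _ => ⟨rfl, rfl⟩⟩

end Duality

/-! ### Regularity and right reductivity -/

theorem singSub_regular (hI : IsTotal I) : IsRegularSemigroup (singSub I) := by
  rintro ⟨a, ha⟩
  obtain ⟨R⟩ := hI.nonempty_retraction (Pow.im a)
  -- The inverse `b` retracts onto `Im a` and then chooses preimages under `a`. Its kernel contains
  -- that of the retraction, which keeps it in the ideal.
  let s : X → X := fun x => (R.map_mem x).choose
  have hs : ∀ x, a.toFun (s x) = R.map.toFun x := fun x => (R.map_mem x).choose_spec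
  have hR : ∀ x y, R.map.toFun x = R.map.toFun y → s x = s y := fun x y h => by
    simp only [s, h]
  let b : Sing X := ⟨s, fun h => R.map.not_injective fun x y k => h (hR x y k), fun h =>
    a.not_injective fun x y k => by
      obtain ⟨x, rfl⟩ := h x
      obtain ⟨y, rfl⟩ := h y
      rw [hs, hs] at k
      exact hR x y k⟩
  refine ⟨⟨b, I.down (c := ker b) (d := ker R.map) (fun x y h => hR x y h) R.ker_mem⟩,
    Subtype.ext (Sing.ext (funext fun x => ?_))⟩
  exact (hs (a.toFun x)).trans (R.map_eq _ ⟨x, rfl⟩)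

theorem singSub_rightReductive [Nontrivial X] (hI : IsTotal I) :
    IsRightReductive (singSub I) := by
  intro a b h
  refine Subtype.ext (Sing.ext (funext fun x => ?_))
  obtain ⟨y, hy⟩ := exists_ne x
  -- Constant maps separate transformations. The kernel of a constant is the coarsest partition, so
  -- it lies in `I` as soon as `I` has any object.
  let k : Sing X := ⟨fun _ => x, fun h => hy (h rfl), fun h => hy (h y).choose_spec.symm⟩
  obtain ⟨p, -⟩ := hI.exists_isTransversal (Pow.im k)
  exact congrFun (congrArg (fun a : singSub I => a.1.toFun)
    (congrFun h ⟨k, I.down (c := ker k) (fun _ _ _ => rfl) p.2⟩)) x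

end Partn

end CrossConnection

theorem mainTheorem8 (X : Type u) [Nontrivial X]
    (I : CrossConnection.CatIdeal (CrossConnection.Partn X))
    (hI : CrossConnection.Partn.IsTotal I) :
    CrossConnection.IsCrossConnection (CrossConnection.Partn.gamma I) ∧
    ∃ Δ : CrossConnection.Pow X ⥤ CrossConnection.NormalDual I.Obj,
      CrossConnection.Partn.IsIdentity I Δ ∧
      Nonempty (CrossConnection.Duality (CrossConnection.Partn.gamma I) Δ) ∧
      (∀ Δ' : CrossConnection.Pow X ⥤ CrossConnection.NormalDual I.Obj,
        Nonempty (CrossConnection.Duality (CrossConnection.Partn.gamma I) Δ') → Δ' = Δ) ∧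
      (∀ χ : CrossConnection.Duality (CrossConnection.Partn.gamma I) Δ,
        ∃ S : Subsemigroup (CrossConnection.NormalCone (CrossConnection.Pow X) ×
            (CrossConnection.NormalCone I.Obj)ᵐᵒᵖ),
          (S : Set (CrossConnection.NormalCone (CrossConnection.Pow X) ×
            (CrossConnection.NormalCone I.Obj)ᵐᵒᵖ)) = CrossConnection.linkedPairs χ ∧
          ∃ φ : CrossConnection.Partn.singSub I ≃* S, ∀ a : CrossConnection.Partn.singSub I,
            (φ a).1.1 = CrossConnection.Pow.rho a.1 ∧
            (φ a).1.2.unop.toSubCone = CrossConnection.Partn.sigmaCone I a.1 a.2) ∧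
      CrossConnection.IsRegularSemigroup (CrossConnection.Partn.singSub I) ∧
      CrossConnection.IsRightReductive (CrossConnection.Partn.singSub I) := by
  let r : ∀ A : CrossConnection.Pow X, CrossConnection.Partn.Retraction I A := fun A =>
    Classical.choice (hI.nonempty_retraction A)
  exact ⟨CrossConnection.Partn.gamma_isCrossConnection hI, CrossConnection.Partn.dual r,
    CrossConnection.Partn.dual_isIdentity r hI, ⟨CrossConnection.Partn.duality r hI⟩,
    fun _ ⟨D⟩ => CrossConnection.Partn.eq_dual D hI r,
    fun D => CrossConnection.Partn.exists_mulEquiv_linkedPairs D hI,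
    CrossConnection.Partn.singSub_regular hI, CrossConnection.Partn.singSub_rightReductive hI⟩
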